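/- Let $\Delta=\{z\in\mathbb C:|z|<1\}$ and $\Omega=\{\lambda\in\mathbb C: |\lambda-1|\le 1,\ \lambda\ne 0\}$. For $\mu\in\Omega$ and $\beta\in[0,1)$ let $G(\mu,\beta)$ be the class of univalent (that is, injective) holomorphic functions $f:\Delta\to\mathbb C\setminus\{0\}$ with $f(0)=1$ and $$\operatorname{Re}\left(\frac{2}{\mu}\cdot\frac{zf'(z)}{f(z)}+\frac{1+z}{1-z}\right)>\beta\qquad\text{for all } z\in\Delta .$$ For holomorphic functions $s_1,s_2$ on $\Delta$ write $s_1\prec s_2$ if there is a holomorphic function $\omega$ on $\Delta$ with $|\omega(z)|\le|z|$ for all $z\in\Delta$ and $s_1=s_2\circ\omega$. All powers are principal powers. Let $f:\Delta\to\mathbb C$ be holomorphic with $f(0)=1$, let $\mu=re^{i\phi}\in\Omega$ with $r>0$ and $\phi\in\mathbb R$, and let $\beta\in[0,1)$. If $\beta=0$, assume in addition that $f$ is not the constant function $1$. Then each of the following conditions (a) and (b) is equivalent to $f\in G(\mu,\beta)$. (a) For all $u,v\in\overline\Delta$, as functions of $z\in\Delta$ (the left-hand one being required to be defined and holomorphic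 on $\Delta$), $$\left(\frac{1-uz}{1-vz}\right)^{\mu}\frac{f(vz)}{f(uz)}\ \prec\ \left(\frac{1-uz}{1-vz}\right)^{(1-\beta)\mu}.$$ (b) For all $t\in(0,2\cos\phi)$ and all $z\in\Delta$ with $f(z)\neq 0$, $$\left|\frac{f\bigl(z(1-e^{-i\phi}t)\bigr)}{f(z)}\right|\le\left|\left(\frac{1-z(1-e^{-i\phi}t)}{1-z}\right)^{\mu}\right|\cdot\left(1-\frac{t}{2\cos\phi}\right)^{-(1-\beta)\operatorname{Re}\mu}.$$ -/

import Mathlib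

open Complex Metric

namespace BoundarySpirallike

/-- The parameter region `Ω = {λ : |λ - 1| ≤ 1, λ ≠ 0}`. -/
def Omega : Set ℂ := {μ | ‖μ - 1‖ ≤ 1 ∧ μ ≠ 0}

/-- The class `G(μ, β)` of functions that are `μ`-spirallike of order `β` with respect to a
boundary point. A function on the open unit disk is represented by a map `ℂ → ℂ`, of which only
the values on the disk matter. The field `ne_zero` makes the quotient `z f'(z) / f(z)`
meaningful. -/
structure IsClassG (μ : ℂ) (β : ℝ) (f : ℂ → ℂ) : Prop where
  holo : DifferentiableOn ℂ f (ball 0 1)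
  univalent : Set.InjOn f (ball 0 1)
  map_zero : f 0 = 1
  ne_zero : ∀ z ∈ ball (0 : ℂ) 1, f z ≠ 0
  re_gt : ∀ z ∈ ball (0 : ℂ) 1,
    β < (2 / μ * (z * deriv f z / f z) + (1 + z) / (1 - z)).re

/-- Subordination `s₁ ≺ s₂` of holomorphic functions on the open unit disk. -/
def Subordinate (s₁ s₂ : ℂ → ℂ) : Prop :=
  DifferentiableOn ℂ s₁ (ball 0 1) ∧ DifferentiableOn ℂ s₂ (ball 0 1) ∧
    ∃ ω : ℂ → ℂ, DifferentiableOn ℂ ω (ball 0 1) ∧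
      (∀ z ∈ ball (0 : ℂ) 1, ‖ω z‖ ≤ ‖z‖) ∧
      ∀ z ∈ ball (0 : ℂ) 1, s₁ z = s₂ (ω z)

/-- The two-point quotient subordination. For `|u|, |v| ≤ 1` and `|z| < 1` the numbers `1 - u z`
and `1 - v z` lie in the right half-plane, so their quotient avoids `(-∞, 0]` and the principal
power is the holomorphic branch with value `1` at `z = 0`. The right-hand function has no zeros,
so the relation (with `x / 0 = 0`) can only hold if `f (u z) ≠ 0` for all `z` in the disk. -/
def TwoPointSubordination (μ : ℂ) (β : ℝ) (f : ℂ → ℂ) : Prop :=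
  ∀ u ∈ closedBall (0 : ℂ) 1, ∀ v ∈ closedBall (0 : ℂ) 1,
    Subordinate
      (fun z => ((1 - u * z) / (1 - v * z)) ^ μ * (f (v * z) / f (u * z)))
      (fun z => ((1 - u * z) / (1 - v * z)) ^ ((1 - (β : ℂ)) * μ))

/-- The modulus inequality, at every point of the disk where the quotient is defined;
`φ` is an argument of `μ`. -/
def ModulusInequality (μ : ℂ) (φ β : ℝ) (f : ℂ → ℂ) : Prop :=
  ∀ t ∈ Set.Ioo (0 : ℝ) (2 * Real.cos φ), ∀ z ∈ ball (0 : ℂ) 1, f z ≠ 0 →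
    ‖f (z * (1 - exp (-(φ * I)) * t)) / f z‖ ≤
      ‖((1 - z * (1 - exp (-(φ * I)) * t)) / (1 - z)) ^ μ‖ *
        (1 - t / (2 * Real.cos φ)) ^ (-(μ.re * (1 - β)))

end BoundarySpirallike

/-! The proof runs through the cycle class ⇒ (a) ⇒ (b) ⇒ class.

Class ⇒ (a). Write `f = exp W` and `T = (W / μ - log (1 - z)) / (1 - β)`, so that the defining
inequality gives `1 + 2 Re (z T') ≥ 0`. By Herglotz, `T b - T a` is an average of the numbers `log
(1 - a w) - log (1 - b w)`, `|w| = 1`, against a probability density. These lie in a closed convex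
set, `logRegion a b`, whose points are exactly the logarithms of the quotients `(1 - a w) / (1 - b
w)` with `|w| ≤ 1`; hence `T b - T a` is itself such a logarithm (`sub_mem_logRegion`). With `a = u
z`, `b = v z`, solving for `w` and multiplying by `z` gives the subordinating function.

(a) ⇒ (b). Take `u = 1` and `v = 1 - exp (-iφ) t`. The modulus of the right-hand function is bounded
by a supporting line of the logarithmic image of a half-plane, which comes down to concavity of `log
cos` (`re_mul_log_ge`).

(b) ⇒ class. A zero of `f` would spread along a segment, so `f` is zero-free. Both sides of (b)
agree at `t = 0`; the right derivative there gives the differential inequality, and the open mapping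
theorem makes it strict. Univalence remains. The function `K = W / μ` is injective by a
Noshiro-Warschawski argument in the variable `1 / (1 - z)`, and `|Im (K b - K a)| < π`. If `f a = f
b`, then `K b - K a` is an integer multiple of `2πi / μ`; since `Re (1 / μ) ≥ 1/2` on `Omega`, the
integer is zero. The function `f = 1` with `β = 0` satisfies everything except injectivity, which is
why it is excluded. -/

namespace BoundarySpirallike

/-! ### Herglotz representation and averages on the unit circle. -/

open Real ComplexConjugate in
/-- The conjugate of a holomorphic function has the mean value property. -/
theorem circleAverage_conj_eq {g : ℂ → ℂ} (hg : DiffContOnCl ℂ g (ball 0 1)) :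
    circleAverage (fun ζ => conj (g ζ)) 0 1 = conj (g 0) := by
  have hg' : DiffContOnCl ℂ g (ball 0 |(1 : ℝ)|) := by simpa using hg
  have hi : CircleIntegrable g 0 1 := by
    apply ContinuousOn.circleIntegrable zero_le_one
    exact hg.continuousOn_ball.mono sphere_subset_closedBall
  rw [← hg'.circleAverage, ← Function.comp_def]
  exact (conjCLE : ℂ →L[ℝ] ℂ).circleAverage_comp_comm hi

theorem one_sub_mem_slitPlane {w : ℂ} (hw : ‖w‖ < 1) : 1 - w ∈ slitPlane := by
  have := mem_slitPlane_of_norm_lt_one (z := -w) (by simpa using hw)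
  simpa [sub_eq_add_neg] using this

theorem one_sub_ne_zero {w : ℂ} (hw : ‖w‖ < 1) : 1 - w ≠ 0 :=
  slitPlane_ne_zero (one_sub_mem_slitPlane hw)

-- Integration by parts in the angle moves the derivative from `S` to the logarithm; the boundary
-- terms cancel by periodicity. What is left is the Cauchy integral of `S` at `a`, corrected by the
-- mean value `S 0 = 0`.
open Real ComplexConjugate in
theorem circleAverage_mul_deriv_mul_log {S : ℂ → ℂ} {ρ : ℝ} (hρ : 1 < ρ)
    (hS : DifferentiableOn ℂ S (ball 0 ρ)) (hS0 : S 0 = 0) {a : ℂ} (ha : ‖a‖ < 1) :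
    circleAverage (fun ζ => ζ * deriv S ζ * Complex.log (1 - a * conj ζ)) 0 1 = - S a := by
  have hsub : closedBall (0 : ℂ) 1 ⊆ ball 0 ρ := closedBall_subset_ball hρ
  have hSc : ContinuousOn S (ball 0 ρ) := hS.continuousOn
  have hS'c : ContinuousOn (deriv S) (ball 0 ρ) := (hS.deriv isOpen_ball).continuousOn
  have hdc : DiffContOnCl ℂ S (ball 0 |(1 : ℝ)|) := by
    rw [abs_one]
    exact hS.diffContOnCl_ball hsub
  have hmem : ∀ θ : ℝ, circleMap 0 1 θ ∈ ball (0 : ℂ) ρ := fun θ => by simp [hρ]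
  have hn : ∀ θ : ℝ, ‖circleMap 0 1 θ‖ = 1 := fun θ => by simp
  have hlt : ∀ ζ : ℂ, ‖ζ‖ = 1 → ‖a * conj ζ‖ < 1 := fun ζ h => by simpa [h] using ha
  have hsa : ∀ ζ : ℂ, ‖ζ‖ = 1 → ζ - a ≠ 0 := fun ζ h h0 => by
    rw [sub_eq_zero.1 h0] at h; linarith
  have hcS : ContinuousOn S (sphere 0 1) := hSc.mono (sphere_subset_closedBall.trans hsub)
  have hcS' : ContinuousOn (deriv S) (sphere 0 1) :=
    hS'c.mono (sphere_subset_closedBall.trans hsub)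
  have hclog : ContinuousOn (fun ζ : ℂ => Complex.log (1 - a * conj ζ)) (sphere 0 1) := by
    apply ContinuousOn.clog (by fun_prop)
    intro ζ hζ
    exact one_sub_mem_slitPlane (hlt ζ (by simpa using hζ))
  have hcq : ContinuousOn (fun ζ : ℂ => a / (ζ - a)) (sphere 0 1) := by
    apply ContinuousOn.div (by fun_prop) (by fun_prop)
    intro ζ hζ
    exact hsa ζ (by simpa using hζ)
  have hI1 : CircleIntegrable (fun ζ => ζ * deriv S ζ * Complex.log (1 - a * conj ζ)) 0 1 :=
    ContinuousOn.circleIntegrable zero_le_one ((continuousOn_id.mul hcS').mul hclog)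
  have hI2 : CircleIntegrable (fun ζ => S ζ * (a / (ζ - a))) 0 1 :=
    ContinuousOn.circleIntegrable zero_le_one (hcS.mul hcq)
  have hparts : circleAverage (fun ζ => ζ * deriv S ζ * Complex.log (1 - a * conj ζ)
      + S ζ * (a / (ζ - a))) 0 1 = 0 := by
    rw [circleAverage_def]
    -- On the unit circle conjugation is `θ ↦ -θ`, which makes the antiholomorphic logarithm
    -- differentiable in `θ`.
    have hder : ∀ θ ∈ Set.uIcc 0 (2 * π), HasDerivAt
        (fun θ : ℝ => -I * (S (circleMap 0 1 θ) * Complex.log (1 - a * circleMap 0 1 (-θ))))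
        (circleMap 0 1 θ * deriv S (circleMap 0 1 θ) *
          Complex.log (1 - a * conj (circleMap 0 1 θ))
          + S (circleMap 0 1 θ) * (a / (circleMap 0 1 θ - a))) θ := by
      intro θ _
      have hcj : conj (circleMap 0 1 θ) = circleMap 0 1 (-θ) := by
        simp [circleMap, ← Complex.exp_conj]
      have h1 : HasDerivAt (fun θ : ℝ => S (circleMap 0 1 θ))
          (deriv S (circleMap 0 1 θ) * (circleMap 0 1 θ * I)) θ := by
        have := ((hS.differentiableAt (isOpen_ball.mem_nhds (hmem θ))).hasDerivAt).scomp_of_eq θ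
          (hasDerivAt_circleMap 0 1 θ) rfl
        simpa [Function.comp_def, mul_comm] using this
      have h2 : HasDerivAt (fun θ : ℝ => circleMap 0 1 (-θ)) (-(circleMap 0 1 (-θ) * I)) θ := by
        have := (hasDerivAt_circleMap 0 1 (-θ)).scomp θ (hasDerivAt_neg θ)
        simpa [Function.comp_def] using this
      have hsl : 1 - a * circleMap 0 1 (-θ) ∈ slitPlane := by
        rw [← hcj]; exact one_sub_mem_slitPlane (hlt _ (hn θ))
      have h3 := ((h2.const_mul a).const_sub 1).clog_real hsl
      have h4 := (h1.mul h3).const_mul (-I)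
      refine h4.congr_deriv ?_
      rw [hcj]
      have hinv : circleMap 0 1 (-θ) = (circleMap 0 1 θ)⁻¹ := by
        simp [circleMap, Complex.exp_neg]
      have h0 : circleMap 0 1 θ ≠ 0 := circleMap_ne_center one_ne_zero
      have h5 : circleMap 0 1 θ - a ≠ 0 := hsa _ (hn θ)
      have h6 := slitPlane_ne_zero hsl
      have h7 : -(a * -(circleMap 0 1 (-θ) * I)) / (1 - a * circleMap 0 1 (-θ)) =
          I * (a / (circleMap 0 1 θ - a)) := by
        rw [hinv] at h6 ⊢
        field_simp
      rw [h7]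
      linear_combination (-(circleMap 0 1 θ * deriv S (circleMap 0 1 θ) *
        Complex.log (1 - a * circleMap 0 1 (-θ)))
        - S (circleMap 0 1 θ) * (a / (circleMap 0 1 θ - a))) * I_sq
    rw [intervalIntegral.integral_eq_sub_of_hasDerivAt hder
      (by simpa [CircleIntegrable] using hI1.add hI2)]
    have : circleMap 0 1 (-(2 * π)) = circleMap 0 1 0 := by
      simp [circleMap, Complex.exp_neg]
    have h' : circleMap 0 1 (2 * π) = circleMap 0 1 0 := by
      simp [circleMap]
    simp [this, h']
  rw [circleAverage_fun_add hI1 hI2] at hparts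
  have hcauchy : circleAverage (fun ζ => S ζ * (a / (ζ - a))) 0 1 = S a := by
    have e1 := hdc.circleAverage_smul_div (w := a) (by simpa using ha)
    have e2 := hdc.circleAverage
    have hI3 : CircleIntegrable S 0 1 := ContinuousOn.circleIntegrable zero_le_one hcS
    have e3 : circleAverage (fun ζ => S ζ * (a / (ζ - a)) + S ζ) 0 1 = S a := by
      rw [← e1]
      apply circleAverage_congr_sphere
      intro ζ hζ
      have := hsa ζ (by simpa using hζ)
      simp only [sub_zero, smul_eq_mul]
      field_simp
      ring
    rwa [circleAverage_fun_add hI2 hI3, e2, hS0, add_zero] at e3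
  rw [hcauchy] at hparts
  exact eq_neg_of_add_eq_zero_left hparts

open Real ComplexConjugate in
/-- A Herglotz representation: averaging `log (1 - a * conj ζ)` against the positive density
`1 + 2 Re (ζ S'(ζ))` recovers `-S`. -/
theorem circleAverage_re_mul_log {S : ℂ → ℂ} {ρ : ℝ} (hρ : 1 < ρ)
    (hS : DifferentiableOn ℂ S (ball 0 ρ)) (hS0 : S 0 = 0) {a : ℂ} (ha : ‖a‖ < 1) :
    circleAverage (fun ζ => ((1 + 2 * (ζ * deriv S ζ).re : ℝ) : ℂ) *
      Complex.log (1 - a * conj ζ)) 0 1 = - S a := by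
  have hsub : closedBall (0 : ℂ) 1 ⊆ ball 0 ρ := closedBall_subset_ball hρ
  have hS' : DifferentiableOn ℂ (deriv S) (ball 0 ρ) := hS.deriv isOpen_ball
  have hlt : ∀ ζ : ℂ, ‖ζ‖ ≤ 1 → ‖conj a * ζ‖ < 1 := fun ζ h => by
    rw [norm_mul, norm_conj]
    nlinarith [norm_nonneg a, norm_nonneg ζ]
  have hlog : DifferentiableOn ℂ (fun ζ => Complex.log (1 - conj a * ζ)) (closedBall 0 1) := by
    apply DifferentiableOn.clog (by fun_prop)
    intro ζ hζ
    exact one_sub_mem_slitPlane (hlt ζ (by simpa using hζ))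
  have hg : DiffContOnCl ℂ (fun ζ => (1 + ζ * deriv S ζ) * Complex.log (1 - conj a * ζ))
      (ball 0 1) := by
    apply DifferentiableOn.diffContOnCl
    rw [closure_ball _ one_ne_zero]
    exact ((differentiableOn_const _).add (differentiableOn_id.mul (hS'.mono hsub))).mul hlog
  have hconj := circleAverage_conj_eq hg
  have hI1 : CircleIntegrable (fun ζ => conj ((1 + ζ * deriv S ζ) *
      Complex.log (1 - conj a * ζ))) 0 1 := by
    apply ContinuousOn.circleIntegrable zero_le_one
    exact continuous_conj.comp_continuousOn
      (hg.continuousOn_ball.mono sphere_subset_closedBall)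
  have hcS' : ContinuousOn (deriv S) (sphere 0 1) :=
    hS'.continuousOn.mono (sphere_subset_closedBall.trans hsub)
  have hclog : ContinuousOn (fun ζ : ℂ => Complex.log (1 - a * conj ζ)) (sphere 0 1) := by
    apply ContinuousOn.clog (by fun_prop)
    intro ζ hζ
    have h1 : ‖ζ‖ = 1 := by simpa using hζ
    exact one_sub_mem_slitPlane (by simpa [h1] using ha)
  have hI2 : CircleIntegrable (fun ζ => ζ * deriv S ζ * Complex.log (1 - a * conj ζ)) 0 1 :=
    ContinuousOn.circleIntegrable zero_le_one ((continuousOn_id.mul hcS').mul hclog)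
  -- Split `2 Re (ζ S')` into `ζ S'` and its conjugate. The conjugate part together with the `1` is
  -- the conjugate of a holomorphic function vanishing at `0`, so it averages to zero.
  have hsum : circleAverage (fun ζ => conj ((1 + ζ * deriv S ζ) * Complex.log (1 - conj a * ζ))
      + ζ * deriv S ζ * Complex.log (1 - a * conj ζ)) 0 1 = - S a := by
    rw [circleAverage_fun_add hI1 hI2, hconj, circleAverage_mul_deriv_mul_log hρ hS hS0 ha]
    simp
  rw [← hsum]
  apply circleAverage_congr_sphere
  intro ζ hζ
  have h1 : ‖ζ‖ = 1 := by simpa using hζ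
  have h2 : conj (Complex.log (1 - conj a * ζ)) = Complex.log (1 - a * conj ζ) := by
    rw [← Complex.log_conj _ (mem_slitPlane_iff_arg.1 (one_sub_mem_slitPlane (hlt ζ h1.le))).1]
    simp
  have h3 : (((1 + 2 * (ζ * deriv S ζ).re : ℝ)) : ℂ) =
      1 + conj (ζ * deriv S ζ) + ζ * deriv S ζ := by
    apply Complex.ext <;> simp <;> ring
  simp only [map_mul, map_add, map_one] at h3 ⊢
  rw [h3, h2]
  ring

open Real MeasureTheory in
/-- A closed convex set is stable under circle averages with respect to a probability density. -/
theorem circleAverage_density_mul_mem {s : Set ℂ} (hs : Convex ℝ s) (hsc : IsClosed s)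
    {P : ℂ → ℝ} {g : ℂ → ℂ} (hP : ContinuousOn P (sphere 0 1)) (hg : ContinuousOn g (sphere 0 1))
    (hP0 : ∀ ζ ∈ sphere (0 : ℂ) 1, 0 ≤ P ζ) (hP1 : circleAverage P 0 1 = 1)
    (hgs : ∀ ζ ∈ sphere (0 : ℂ) 1, g ζ ∈ s) :
    circleAverage (fun ζ => (P ζ : ℂ) * g ζ) 0 1 ∈ s := by
  have hm : ∀ θ : ℝ, circleMap 0 1 θ ∈ sphere (0 : ℂ) 1 := fun θ => by simp
  have h2π : (0 : ℝ) ≤ 2 * π := by positivity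
  set p : ℝ → ℝ := fun θ => (2 * π)⁻¹ * P (circleMap 0 1 θ) with hp
  have hpc : Continuous p :=
    continuous_const.mul (hP.comp_continuous (continuous_circleMap 0 1) hm)
  have hgc : Continuous fun θ => g (circleMap 0 1 θ) :=
    hg.comp_continuous (continuous_circleMap 0 1) hm
  have hp0 : ∀ θ, 0 ≤ p θ := fun θ => mul_nonneg (by positivity) (hP0 _ (hm θ))
  set ν : Measure ℝ := volume.restrict (Set.Ioc 0 (2 * π)) with hν
  have hpi : Integrable p ν := (hpc.integrableOn_Ioc)
  have hp1 : ∫ θ, p θ ∂ν = 1 := by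
    rw [circleAverage_def, intervalIntegral.integral_of_le h2π, smul_eq_mul,
      ← integral_const_mul] at hP1
    exact hP1
  set q : ℝ → NNReal := fun θ => (p θ).toNNReal with hq
  have hqm : Measurable q := hpc.measurable.real_toNNReal
  have hqp : ∀ θ, (q θ : ℝ) = p θ := fun θ => Real.coe_toNNReal _ (hp0 θ)
  have hprob : IsProbabilityMeasure (ν.withDensity fun θ => (q θ : ENNReal)) := by
    constructor
    rw [withDensity_apply _ MeasurableSet.univ, Measure.restrict_univ]
    have := ofReal_integral_eq_lintegral_ofReal hpi (Filter.Eventually.of_forall hp0)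
    rw [hp1, ENNReal.ofReal_one] at this
    exact this.symm
  have hint : ∫ θ, g (circleMap 0 1 θ) ∂(ν.withDensity fun θ => (q θ : ENNReal)) =
      circleAverage (fun ζ => (P ζ : ℂ) * g ζ) 0 1 := by
    rw [integral_withDensity_eq_integral_smul hqm, circleAverage_def,
      intervalIntegral.integral_of_le h2π, ← integral_smul]
    congr 1
    ext1 θ
    rw [NNReal.smul_def, hqp]
    simp only [hp, Complex.real_smul]
    push_cast
    ring
  rw [← hint]
  refine hs.integral_mem hsc (Filter.Eventually.of_forall fun θ => hgs _ (hm θ)) ?_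
  rw [integrable_withDensity_iff_integrable_smul hqm]
  have : (fun θ => q θ • g (circleMap 0 1 θ)) = fun θ => p θ • g (circleMap 0 1 θ) := by
    ext1 θ
    rw [NNReal.smul_def, hqp]
  rw [this]
  exact (hpc.smul hgc).integrableOn_Ioc

/-! ### The convex region of logarithms of Möbius quotients. -/

theorem abs_log_im_lt_of_re_pos {w : ℂ} (hw : 0 < w.re) : |(log w).im| < Real.pi / 2 := by
  rw [log_im]; exact abs_arg_lt_pi_div_two_iff.2 (Or.inl hw)

theorem one_sub_re_pos {w : ℂ} (hw : ‖w‖ < 1) : 0 < (1 - w).re := by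
  have := (re_le_norm w).trans_lt hw
  simpa using this

theorem abs_lt_pi_div_two_of_cos_pos {x : ℝ} (hx : |x| < 3 * Real.pi / 2)
    (hc : 0 < Real.cos x) : |x| < Real.pi / 2 := by
  by_contra! h
  have := Real.cos_nonpos_of_pi_div_two_le_of_le h (by linarith)
  rw [Real.cos_abs] at this
  linarith

open ComplexConjugate in
/-- The set of logarithms `q` with `|Im q| < π` of points `m` with `‖1 - m‖ ≤ ‖a - b * m‖`,
in a form that exhibits its convexity. -/
def logRegion (a b : ℂ) : Set ℂ :=
  {q | |q.im + arg (1 - conj a * b)| ≤ Real.pi / 2 ∧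
    (1 - ‖b‖ ^ 2) * Real.exp q.re + (1 - ‖a‖ ^ 2) * Real.exp (-q.re) ≤
      2 * ‖1 - conj a * b‖ * Real.cos (q.im + arg (1 - conj a * b))}

theorem isClosed_logRegion (a b : ℂ) : IsClosed (logRegion a b) := by
  apply IsClosed.and <;> apply isClosed_le <;> fun_prop

/-- The left side of the defining inequality is a nonnegative combination of exponentials of `± Re
q`, hence convex; the right side is concave because the shifted imaginary part stays where cosine is
concave. -/
theorem convex_logRegion {a b : ℂ} (ha : ‖a‖ < 1) (hb : ‖b‖ < 1) : Convex ℝ (logRegion a b) := by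
  rintro x ⟨hx1, hx2⟩ y ⟨hy1, hy2⟩ s t hs ht hst
  set α := arg (1 - (starRingEnd ℂ) a * b)
  set B := ‖1 - (starRingEnd ℂ) a * b‖
  have hA : 0 ≤ 1 - ‖b‖ ^ 2 := by nlinarith [norm_nonneg b]
  have hC : 0 ≤ 1 - ‖a‖ ^ 2 := by nlinarith [norm_nonneg a]
  have hB : 0 ≤ 2 * B := mul_nonneg zero_le_two (norm_nonneg _)
  have him : (s • x + t • y).im + α = s * (x.im + α) + t * (y.im + α) := by
    simp only [add_im, smul_im, smul_eq_mul]
    linear_combination (-α) * hst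
  have hre : (s • x + t • y).re = s * x.re + t * y.re := by simp
  have hre' : -(s • x + t • y).re = s * (-x.re) + t * (-y.re) := by simp; ring
  rw [abs_le] at hx1 hy1
  have hcos := strictConcaveOn_cos_Icc.concaveOn.2 hx1 hy1 hs ht hst
  have he1 := convexOn_exp.2 (Set.mem_univ x.re) (Set.mem_univ y.re) hs ht hst
  have he2 := convexOn_exp.2 (Set.mem_univ (-x.re)) (Set.mem_univ (-y.re)) hs ht hst
  simp only [smul_eq_mul] at hcos he1 he2
  refine ⟨?_, ?_⟩
  · change |(s • x + t • y).im + α| ≤ _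
    rw [him, abs_le]
    constructor <;> nlinarith
  · change _ ≤ 2 * B * Real.cos ((s • x + t • y).im + α)
    rw [him, hre', hre]
    have h1 := mul_le_mul_of_nonneg_left hcos hB
    have h2 := mul_le_mul_of_nonneg_left he1 hA
    have h3 := mul_le_mul_of_nonneg_left he2 hC
    have h4 := mul_le_mul_of_nonneg_left hx2 hs
    have h5 := mul_le_mul_of_nonneg_left hy2 ht
    linarith

-- Dividing the squared inequality by `|exp q|` separates `Re q` from `Im q`; this is what makes the
-- convexity visible.
open ComplexConjugate in
theorem norm_one_sub_exp_sq_sub (a b q : ℂ) :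
    ‖1 - exp q‖ ^ 2 - ‖a - b * exp q‖ ^ 2 = Real.exp q.re *
      ((1 - ‖b‖ ^ 2) * Real.exp q.re + (1 - ‖a‖ ^ 2) * Real.exp (-q.re) -
      2 * ‖1 - conj a * b‖ * Real.cos (q.im + arg (1 - conj a * b))) := by
  have hB := norm_mul_cos_arg (1 - conj a * b)
  have hB' := norm_mul_sin_arg (1 - conj a * b)
  have he : Real.exp q.re * Real.exp (-q.re) = 1 := by rw [← Real.exp_add]; simp
  have hsc := Real.sin_sq_add_cos_sq q.im
  rw [Real.cos_add]
  have h1 : 2 * ‖1 - conj a * b‖ * (Real.cos q.im * Real.cos (arg (1 - conj a * b)) -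
      Real.sin q.im * Real.sin (arg (1 - conj a * b))) =
      2 * (Real.cos q.im * (1 - conj a * b).re - Real.sin q.im * (1 - conj a * b).im) := by
    rw [← hB, ← hB']; ring
  rw [h1]
  simp only [← normSq_eq_norm_sq, normSq_apply, sub_re, sub_im, mul_re, mul_im, exp_re, exp_im,
    one_re, one_im, conj_re, conj_im]
  linear_combination (1 - a.re * a.re - a.im * a.im) * (-he) +
    (1 - b.re ^ 2 - b.im ^ 2) * Real.exp q.re ^ 2 * hsc

open ComplexConjugate in
theorem mem_logRegion_iff {a b : ℂ} (ha : ‖a‖ < 1) (hb : ‖b‖ < 1) {q : ℂ} :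
    q ∈ logRegion a b ↔ |q.im| < Real.pi ∧ ‖1 - exp q‖ ≤ ‖a - b * exp q‖ := by
  have hab : ‖conj a * b‖ < 1 := by
    rw [norm_mul, norm_conj]; nlinarith [norm_nonneg a, norm_nonneg b]
  have hα : |arg (1 - conj a * b)| < Real.pi / 2 :=
    abs_arg_lt_pi_div_two_iff.2 (Or.inl (one_sub_re_pos hab))
  have hB : 0 < ‖1 - conj a * b‖ := norm_pos_iff.2 (one_sub_ne_zero hab)
  have hA : 0 < 1 - ‖b‖ ^ 2 := by nlinarith [norm_nonneg b]
  have hC : 0 < 1 - ‖a‖ ^ 2 := by nlinarith [norm_nonneg a]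
  have hid := norm_one_sub_exp_sq_sub a b q
  have hE := Real.exp_pos q.re
  have hE' := Real.exp_pos (-q.re)
  rw [abs_lt] at hα
  constructor
  · rintro ⟨h1, h2⟩
    rw [abs_le] at h1
    refine ⟨abs_lt.2 ⟨by linarith, by linarith⟩, ?_⟩
    rw [← sq_le_sq₀ (norm_nonneg _) (norm_nonneg _)]
    nlinarith
  · rintro ⟨h1, h2⟩
    rw [← sq_le_sq₀ (norm_nonneg _) (norm_nonneg _)] at h2
    have h3 : (1 - ‖b‖ ^ 2) * Real.exp q.re + (1 - ‖a‖ ^ 2) * Real.exp (-q.re) ≤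
        2 * ‖1 - conj a * b‖ * Real.cos (q.im + arg (1 - conj a * b)) := by
      by_contra! h
      have := mul_pos hE (sub_pos.2 h)
      linarith
    -- The inequality forces the cosine to be positive, and the angle is a priori below `π + π/2`,
    -- so it cannot lie in another period.
    refine ⟨(abs_lt_pi_div_two_of_cos_pos ?_ ?_).le, h3⟩
    · rw [abs_lt] at h1 ⊢
      constructor <;> linarith
    · by_contra! h
      have h4 := mul_pos hA hE
      have h5 := mul_pos hC hE'
      nlinarith

theorem log_sub_log_mem_logRegion {a b : ℂ} (ha : ‖a‖ < 1) (hb : ‖b‖ < 1) {w : ℂ} (hw : ‖w‖ = 1) :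
    log (1 - a * w) - log (1 - b * w) ∈ logRegion a b := by
  have haw : ‖a * w‖ < 1 := by simpa [hw] using ha
  have hbw : ‖b * w‖ < 1 := by simpa [hw] using hb
  have h1 := abs_lt.1 (abs_log_im_lt_of_re_pos (one_sub_re_pos haw))
  have h2 := abs_lt.1 (abs_log_im_lt_of_re_pos (one_sub_re_pos hbw))
  have h3 := one_sub_ne_zero hbw
  rw [mem_logRegion_iff ha hb]
  refine ⟨?_, ?_⟩
  · rw [sub_im, abs_lt]
    constructor <;> linarith
  · rw [exp_sub, exp_log (one_sub_ne_zero haw), exp_log h3]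
    have e1 : 1 - (1 - a * w) / (1 - b * w) = w * ((a - b) / (1 - b * w)) := by
      rw [one_sub_div h3, ← mul_div_assoc]
      congr 1
      ring
    have e2 : a - b * ((1 - a * w) / (1 - b * w)) = (a - b) / (1 - b * w) := by
      field_simp; ring
    rw [e1, e2, norm_mul, hw, one_mul]

/-! ### Differences `T b - T a` lie in the region. -/

open Real ComplexConjugate in
theorem sub_mem_logRegion_of_differentiableOn {S : ℂ → ℂ} {ρ : ℝ} (hρ : 1 < ρ)
    (hS : DifferentiableOn ℂ S (ball 0 ρ)) (hS0 : S 0 = 0)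
    (hre : ∀ ζ ∈ sphere (0 : ℂ) 1, 0 ≤ 1 + 2 * (ζ * deriv S ζ).re)
    {a b : ℂ} (ha : ‖a‖ < 1) (hb : ‖b‖ < 1) : S b - S a ∈ logRegion a b := by
  have hsub : closedBall (0 : ℂ) 1 ⊆ ball 0 ρ := closedBall_subset_ball hρ
  have hS' : DifferentiableOn ℂ (deriv S) (ball 0 ρ) := hS.deriv isOpen_ball
  have hcS' : ContinuousOn (deriv S) (sphere 0 1) :=
    hS'.continuousOn.mono (sphere_subset_closedBall.trans hsub)
  have hP : ContinuousOn (fun ζ => 1 + 2 * (ζ * deriv S ζ).re) (sphere 0 1) :=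
    continuousOn_const.add (continuousOn_const.mul
      (continuous_re.comp_continuousOn (continuousOn_id.mul hcS')))
  have hlog : ∀ c : ℂ, ‖c‖ < 1 →
      ContinuousOn (fun ζ : ℂ => Complex.log (1 - c * conj ζ)) (sphere 0 1) := by
    intro c hc
    apply ContinuousOn.clog (by fun_prop)
    intro ζ hζ
    have h1 : ‖ζ‖ = 1 := by simpa using hζ
    exact one_sub_mem_slitPlane (by simpa [h1] using hc)
  have hP1 : circleAverage (fun ζ => 1 + 2 * (ζ * deriv S ζ).re) 0 1 = 1 := by
    have hd : DiffContOnCl ℂ (fun ζ => 1 + 2 * (ζ * deriv S ζ)) (ball 0 |(1 : ℝ)|) := by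
      rw [abs_one]
      apply DifferentiableOn.diffContOnCl
      rw [closure_ball _ one_ne_zero]
      exact (differentiableOn_const _).add
        ((differentiableOn_const _).mul (differentiableOn_id.mul (hS'.mono hsub)))
    have hi : CircleIntegrable (fun ζ => 1 + 2 * (ζ * deriv S ζ)) 0 1 :=
      ContinuousOn.circleIntegrable zero_le_one
        (continuousOn_const.add (continuousOn_const.mul (continuousOn_id.mul hcS')))
    have h1 := reCLM.circleAverage_comp_comm hi
    rw [hd.circleAverage] at h1
    simpa [Function.comp_def] using h1
  have key := circleAverage_density_mul_mem (convex_logRegion ha hb) (isClosed_logRegion a b) hP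
    ((hlog a ha).sub (hlog b hb)) hre hP1 (fun ζ hζ => by
      apply log_sub_log_mem_logRegion ha hb
      simpa using hζ)
  have hint : ∀ c : ℂ, ‖c‖ < 1 → CircleIntegrable (fun ζ =>
      ((1 + 2 * (ζ * deriv S ζ).re : ℝ) : ℂ) * Complex.log (1 - c * conj ζ)) 0 1 := fun c hc =>
    ContinuousOn.circleIntegrable zero_le_one
      ((continuous_ofReal.comp_continuousOn hP).mul (hlog c hc))
  have heq : S b - S a = circleAverage (fun ζ => ((1 + 2 * (ζ * deriv S ζ).re : ℝ) : ℂ) *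
      (Complex.log (1 - a * conj ζ) - Complex.log (1 - b * conj ζ))) 0 1 := by
    simp only [mul_sub]
    rw [circleAverage_fun_sub (hint a ha) (hint b hb), circleAverage_re_mul_log hρ hS hS0 ha,
      circleAverage_re_mul_log hρ hS hS0 hb]
    ring
  rw [heq]
  exact key

/-- If `1 + 2 Re (z T'(z)) ≥ 0` on the disk and `T 0 = 0`, then `T b - T a` is the logarithm of a
quotient `(1 - l a) / (1 - l b)` with `‖l‖ ≤ 1`. -/
theorem sub_mem_logRegion {T : ℂ → ℂ} (hT : DifferentiableOn ℂ T (ball 0 1)) (hT0 : T 0 = 0)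
    (hre : ∀ z ∈ ball (0 : ℂ) 1, 0 ≤ 1 + 2 * (z * deriv T z).re)
    {a b : ℂ} (ha : ‖a‖ < 1) (hb : ‖b‖ < 1) : T b - T a ∈ logRegion a b := by
  -- The dilations `T (R z)` are holomorphic across the unit circle; closedness of the region allows
  -- `R → 1`.
  have hmem : ∀ᶠ R : ℝ in nhdsWithin 1 (Set.Iio 1), T (R * b) - T (R * a) ∈ logRegion a b := by
    have hev : ∀ᶠ R : ℝ in nhdsWithin 1 (Set.Iio 1), R ∈ Set.Ioo (0 : ℝ) 1 :=
      Ioo_mem_nhdsLT zero_lt_one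
    filter_upwards [hev] with R hR
    have hball : ∀ z ∈ ball (0 : ℂ) R⁻¹, (R : ℂ) * z ∈ ball (0 : ℂ) 1 := by
      intro z hz
      rw [mem_ball_zero_iff] at hz ⊢
      rw [norm_mul, norm_real, Real.norm_of_nonneg hR.1.le]
      have := mul_lt_mul_of_pos_left hz hR.1
      rwa [mul_inv_cancel₀ hR.1.ne'] at this
    have h1R : 1 < R⁻¹ := (one_lt_inv₀ hR.1).2 hR.2
    have hd : ∀ z ∈ ball (0 : ℂ) R⁻¹,
        HasDerivAt (fun z => T (R * z)) (deriv T (R * z) * R) z := fun z hz => by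
      have h2 := (hT.differentiableAt (isOpen_ball.mem_nhds (hball z hz))).hasDerivAt
      have h3 : HasDerivAt (fun z : ℂ => (R : ℂ) * z) R z := by
        simpa using (hasDerivAt_id z).const_mul (R : ℂ)
      exact h2.comp z h3
    refine sub_mem_logRegion_of_differentiableOn (S := fun z => T (R * z)) h1R
      (fun z hz => (hd z hz).differentiableAt.differentiableWithinAt) (by simpa using hT0) ?_ ha hb
    intro ζ hζ
    have hζ' : ζ ∈ ball (0 : ℂ) R⁻¹ := by
      rw [mem_sphere_zero_iff_norm] at hζ
      rw [mem_ball_zero_iff, hζ]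
      exact h1R
    rw [(hd ζ hζ').deriv]
    have := hre _ (hball ζ hζ')
    rwa [show ζ * (deriv T (R * ζ) * R) = R * ζ * deriv T (R * ζ) by ring]
  have hlim : ∀ c : ℂ, ‖c‖ < 1 → Filter.Tendsto (fun R : ℝ => T (R * c))
      (nhdsWithin 1 (Set.Iio 1)) (nhds (T c)) := by
    intro c hc
    have h1 : ContinuousAt T c :=
      (hT.differentiableAt (isOpen_ball.mem_nhds (by simpa using hc))).continuousAt
    have h2 : Filter.Tendsto (fun R : ℝ => (R : ℂ) * c) (nhds 1) (nhds c) := by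
      have : Continuous fun R : ℝ => (R : ℂ) * c := by fun_prop
      simpa using this.tendsto 1
    exact h1.tendsto.comp (h2.mono_left nhdsWithin_le_nhds)
  exact (isClosed_logRegion a b).mem_of_tendsto ((hlim b hb).sub (hlim a ha)) hmem

/-! ### From the class to the two-point subordination. -/

/-- A zero-free holomorphic function on the disk has a holomorphic logarithm. -/
theorem exists_holomorphic_log {f : ℂ → ℂ} (hf : DifferentiableOn ℂ f (ball 0 1)) (hf0 : f 0 = 1)
    (hne : ∀ z ∈ ball (0 : ℂ) 1, f z ≠ 0) :
    ∃ W : ℂ → ℂ, W 0 = 0 ∧ (∀ z ∈ ball (0 : ℂ) 1, HasDerivAt W (deriv f z / f z) z) ∧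
      ∀ z ∈ ball (0 : ℂ) 1, f z = exp (W z) := by
  have hd : DifferentiableOn ℂ (fun z => deriv f z / f z) (ball 0 1) :=
    (hf.deriv isOpen_ball).div hf hne
  obtain ⟨W, hW0, hW⟩ := hd.isExactOn_ball.with_val_at 0 0
  refine ⟨W, hW0, hW, fun z hz => ?_⟩
  have hder : ∀ w ∈ ball (0 : ℂ) 1, HasDerivAt (fun w => f w * exp (-W w)) 0 w := fun w hw => by
    have h1 := (hf.differentiableAt (isOpen_ball.mem_nhds hw)).hasDerivAt
    refine (h1.mul (hW w hw).neg.cexp).congr_deriv ?_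
    have := hne w hw
    field_simp
    ring
  have hconst := isOpen_ball.is_const_of_deriv_eq_zero (convex_ball (0 : ℂ) 1).isPreconnected
    (fun w hw => (hder w hw).differentiableAt.differentiableWithinAt)
    (fun w hw => (hder w hw).deriv) hz (mem_ball_self zero_lt_one)
  simp only [hW0, hf0, neg_zero, exp_zero, mul_one, exp_neg] at hconst
  have := exp_ne_zero (W z)
  field_simp at hconst
  exact hconst

/-- Both arguments are below `π/2` in modulus, so no branch jump occurs in the difference. -/
theorem log_one_sub_div {a b : ℂ} (ha : ‖a‖ < 1) (hb : ‖b‖ < 1) :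
    log ((1 - a) / (1 - b)) = log (1 - a) - log (1 - b) := by
  have h1 := abs_lt.1 (abs_log_im_lt_of_re_pos (one_sub_re_pos ha))
  have h2 := abs_lt.1 (abs_log_im_lt_of_re_pos (one_sub_re_pos hb))
  rw [← log_exp (x := log (1 - a) - log (1 - b)), exp_sub, exp_log (one_sub_ne_zero ha),
    exp_log (one_sub_ne_zero hb)]
  all_goals
    rw [sub_im]
    linarith

theorem one_sub_div_ne_zero {a b : ℂ} (ha : ‖a‖ < 1) (hb : ‖b‖ < 1) : (1 - a) / (1 - b) ≠ 0 :=
  div_ne_zero (one_sub_ne_zero ha) (one_sub_ne_zero hb)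

theorem one_sub_div_cpow {a b : ℂ} (ha : ‖a‖ < 1) (hb : ‖b‖ < 1) (s : ℂ) :
    ((1 - a) / (1 - b)) ^ s = exp ((log (1 - a) - log (1 - b)) * s) := by
  rw [cpow_def_of_ne_zero (one_sub_div_ne_zero ha hb), log_one_sub_div ha hb]

theorem one_sub_div_mem_slitPlane {a b : ℂ} (ha : ‖a‖ < 1) (hb : ‖b‖ < 1) :
    (1 - a) / (1 - b) ∈ slitPlane := by
  have h1 := abs_lt.1 (abs_log_im_lt_of_re_pos (one_sub_re_pos ha))
  have h2 := abs_lt.1 (abs_log_im_lt_of_re_pos (one_sub_re_pos hb))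
  refine mem_slitPlane_iff_arg.2 ⟨?_, one_sub_div_ne_zero ha hb⟩
  rw [← log_im, log_one_sub_div ha hb, sub_im]
  linarith

theorem norm_mul_lt_one {u z : ℂ} (hu : ‖u‖ ≤ 1) (hz : ‖z‖ < 1) : ‖u * z‖ < 1 := by
  rw [norm_mul]
  nlinarith [norm_nonneg u, norm_nonneg z]

/-- Normalised logarithm: for `f = exp W` in the class, `z * exp (2 * T)` is starlike. -/
noncomputable def normLog (μ : ℂ) (β : ℝ) (W : ℂ → ℂ) (z : ℂ) : ℂ :=
  (W z / μ - log (1 - z)) / (1 - β)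

section

variable {f W : ℂ → ℂ} {μ : ℂ} {β : ℝ}

theorem hasDerivAt_normLog (hW : ∀ z ∈ ball (0 : ℂ) 1, HasDerivAt W (deriv f z / f z) z)
    {z : ℂ} (hz : z ∈ ball (0 : ℂ) 1) :
    HasDerivAt (normLog μ β W) ((deriv f z / f z / μ + 1 / (1 - z)) / (1 - β)) z := by
  have hz' : ‖z‖ < 1 := by simpa using hz
  have h1 : HasDerivAt (fun z : ℂ => log (1 - z)) (-1 / (1 - z)) z :=
    ((hasDerivAt_id z).const_sub 1).clog (one_sub_mem_slitPlane hz')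
  have h2 := (((hW z hz).div_const μ).sub h1).div_const (1 - β : ℂ)
  refine h2.congr_deriv ?_
  ring

theorem differentiableOn_normLog
    (hW : ∀ z ∈ ball (0 : ℂ) 1, HasDerivAt W (deriv f z / f z) z) :
    DifferentiableOn ℂ (normLog μ β W) (ball 0 1) := fun _ hz =>
  (hasDerivAt_normLog hW hz).differentiableAt.differentiableWithinAt

theorem normLog_sub_mem_logRegion (hβ : β < 1) (hW0 : W 0 = 0)
    (hW : ∀ z ∈ ball (0 : ℂ) 1, HasDerivAt W (deriv f z / f z) z)
    (hre : ∀ z ∈ ball (0 : ℂ) 1,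
      β ≤ (2 / μ * (z * deriv f z / f z) + (1 + z) / (1 - z)).re)
    {a b : ℂ} (ha : ‖a‖ < 1) (hb : ‖b‖ < 1) :
    normLog μ β W b - normLog μ β W a ∈ logRegion a b := by
  refine sub_mem_logRegion (differentiableOn_normLog hW) (by simp [normLog, hW0])
    (fun z hz => ?_) ha hb
  rw [(hasDerivAt_normLog hW hz).deriv]
  have hz1 := one_sub_ne_zero (w := z) (by simpa using hz)
  have hβ' : 0 < 1 - β := sub_pos.2 hβ
  -- With `p` the spirallike expression, `1 + 2 z T' = (p - β) / (1 - β)`.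
  have e : z * ((deriv f z / f z / μ + 1 / (1 - z)) / (1 - β)) =
      (((1 - β)⁻¹ : ℝ) : ℂ) *
        ((2 / μ * (z * deriv f z / f z) + (1 + z) / (1 - z) - 1) / 2) := by
    have : (1 + z) / (1 - z) = 1 + 2 * z / (1 - z) := by field_simp; ring
    rw [this]
    push_cast
    ring
  have h := hre z hz
  set p := 2 / μ * (z * deriv f z / f z) + (1 + z) / (1 - z)
  rw [e, re_ofReal_mul]
  have e2 : ((p - 1) / 2).re = (p.re - 1) / 2 := by simp
  have e3 : 1 + 2 * ((1 - β)⁻¹ * ((p.re - 1) / 2)) = (1 - β)⁻¹ * (p.re - β) := by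
    field_simp; ring
  rw [e2, e3]
  exact mul_nonneg (inv_nonneg.2 hβ'.le) (sub_nonneg.2 h)

/-- A value of `exp` on the region is a quotient `(1 - u * w) / (1 - v * w)`. -/
theorem exists_exp_eq_of_mem_logRegion {u v z q : ℂ} (hu : ‖u * z‖ < 1) (hv : ‖v * z‖ < 1)
    (huv : u ≠ v) (hq : q ∈ logRegion (u * z) (v * z)) :
    u - v * exp q ≠ 0 ∧ ‖(1 - exp q) / (u - v * exp q)‖ ≤ ‖z‖ ∧
      (1 - u * ((1 - exp q) / (u - v * exp q))) / (1 - v * ((1 - exp q) / (u - v * exp q))) =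
        exp q := by
  have h1 := ((mem_logRegion_iff hu hv).1 hq).2
  have e : u * z - v * z * exp q = z * (u - v * exp q) := by ring
  rw [e, norm_mul] at h1
  have hne : u - v * exp q ≠ 0 := fun h0 => huv <| by
    rw [h0, norm_zero, mul_zero] at h1
    have h2 : exp q = 1 := (sub_eq_zero.1 (norm_le_zero_iff.1 h1)).symm
    rw [h2, mul_one] at h0
    exact sub_eq_zero.1 h0
  refine ⟨hne, ?_, ?_⟩
  · rw [norm_div]
    exact div_le_of_le_mul₀ (norm_nonneg _) (norm_nonneg _) h1
  · have huv' : u - v ≠ 0 := sub_ne_zero.2 huv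
    have e1 : 1 - u * ((1 - exp q) / (u - v * exp q)) =
        (u - v) * exp q / (u - v * exp q) := by
      rw [eq_div_iff hne, sub_mul, mul_assoc, div_mul_cancel₀ _ hne]; ring
    have e2 : 1 - v * ((1 - exp q) / (u - v * exp q)) = (u - v) / (u - v * exp q) := by
      rw [eq_div_iff hne, sub_mul, mul_assoc, div_mul_cancel₀ _ hne]; ring
    rw [e1, e2, div_div_div_cancel_right₀ hne, mul_div_cancel_left₀ _ huv']

theorem differentiableOn_one_sub_div_cpow {u v : ℂ} (hu : ‖u‖ ≤ 1) (hv : ‖v‖ ≤ 1) (s : ℂ) :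
    DifferentiableOn ℂ (fun z => ((1 - u * z) / (1 - v * z)) ^ s) (ball 0 1) := by
  have h : ∀ z ∈ ball (0 : ℂ) 1, ‖z‖ < 1 := fun z hz => by simpa using hz
  refine DifferentiableOn.cpow_const (DifferentiableOn.div (by fun_prop) (by fun_prop)
    fun z hz => one_sub_ne_zero (norm_mul_lt_one hv (h z hz))) fun z hz =>
    one_sub_div_mem_slitPlane (norm_mul_lt_one hu (h z hz)) (norm_mul_lt_one hv (h z hz))

theorem differentiableOn_comp_const_mul {g : ℂ → ℂ} (hg : DifferentiableOn ℂ g (ball 0 1))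
    {u : ℂ} (hu : ‖u‖ ≤ 1) : DifferentiableOn ℂ (fun z => g (u * z)) (ball 0 1) :=
  hg.comp (f := fun z => u * z) (by fun_prop) fun z hz => by
    simpa using norm_mul_lt_one hu (by simpa using hz)

theorem IsClassG.twoPointSubordination (hμ : μ ≠ 0) (hβ : β < 1) (hG : IsClassG μ β f) :
    TwoPointSubordination μ β f := by
  intro u hu v hv
  rw [mem_closedBall_zero_iff] at hu hv
  obtain ⟨W, hW0, hW, hfW⟩ := exists_holomorphic_log hG.holo hG.map_zero hG.ne_zero
  have hun : ∀ z ∈ ball (0 : ℂ) 1, ‖u * z‖ < 1 := fun z hz =>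
    norm_mul_lt_one hu (by simpa using hz)
  have hvn : ∀ z ∈ ball (0 : ℂ) 1, ‖v * z‖ < 1 := fun z hz =>
    norm_mul_lt_one hv (by simpa using hz)
  refine ⟨(differentiableOn_one_sub_div_cpow hu hv μ).mul
    ((differentiableOn_comp_const_mul hG.holo hv).div (differentiableOn_comp_const_mul hG.holo hu)
      fun z hz => hG.ne_zero _ (by simpa using hun z hz)),
    differentiableOn_one_sub_div_cpow hu hv _, ?_⟩
  set q : ℂ → ℂ := fun z => normLog μ β W (v * z) - normLog μ β W (u * z) with hqdef
  have hβ' : (1 - β : ℂ) ≠ 0 := by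
    exact_mod_cast (sub_pos.2 hβ).ne'
  have hlhs : ∀ z ∈ ball (0 : ℂ) 1, ((1 - u * z) / (1 - v * z)) ^ μ * (f (v * z) / f (u * z)) =
      exp (q z * ((1 - β) * μ)) := by
    intro z hz
    rw [one_sub_div_cpow (hun z hz) (hvn z hz), hfW _ (by simpa using hvn z hz),
      hfW _ (by simpa using hun z hz), ← exp_sub, ← exp_add]
    congr 1
    simp only [hqdef, normLog]
    field_simp
    ring
  rcases eq_or_ne u v with rfl | huv
  -- For `u = v` both sides are constantly `1`, and the general formula for `ω` could degenerate to
  -- `0 / 0`.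
  · refine ⟨fun _ => 0, differentiableOn_const _, fun z _ => by simp, fun z hz => ?_⟩
    simp only [hlhs z hz]
    simp [hqdef]
  have hmem : ∀ z ∈ ball (0 : ℂ) 1, q z ∈ logRegion (u * z) (v * z) := fun z hz =>
    normLog_sub_mem_logRegion hβ hW0 hW (fun w hw => (hG.re_gt w hw).le) (hun z hz) (hvn z hz)
  have hqd : DifferentiableOn ℂ q (ball 0 1) :=
    (differentiableOn_comp_const_mul (differentiableOn_normLog hW) hv).sub
      (differentiableOn_comp_const_mul (differentiableOn_normLog hW) hu)
  have key := fun z hz =>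
    exists_exp_eq_of_mem_logRegion (hun z hz) (hvn z hz) huv (hmem z hz)
  -- This is the solution `ω` of `(1 - u ω) / (1 - v ω) = exp q`.
  refine ⟨fun z => (1 - exp (q z)) / (u - v * exp (q z)), ?_, fun z hz => (key z hz).2.1,
    fun z hz => ?_⟩
  · exact DifferentiableOn.div ((differentiableOn_const _).sub hqd.cexp)
      ((differentiableOn_const _).sub ((differentiableOn_const _).mul hqd.cexp))
      fun z hz => (key z hz).1
  -- Since `|Im q| < π`, the principal logarithm of `exp q` is `q`, so the principal power on the
  -- right is the intended branch.
  · have him := abs_lt.1 ((mem_logRegion_iff (hun z hz) (hvn z hz)).1 (hmem z hz)).1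
    simp only [hlhs z hz]
    rw [(key z hz).2.2, cpow_def_of_ne_zero (exp_ne_zero _), log_exp him.1 him.2.le]

end

/-! ### From the two-point subordination to the modulus inequality. -/

theorem re_pos_of_mem_Omega {μ : ℂ} (hμ : μ ∈ Omega) : 0 < μ.re ∧ ‖μ‖ ^ 2 ≤ 2 * μ.re := by
  obtain ⟨h1, h2⟩ := hμ
  have h3 : ‖μ - 1‖ ^ 2 ≤ 1 := by nlinarith [norm_nonneg (μ - 1)]
  have h4 : 0 < ‖μ‖ ^ 2 := by positivity
  have h5 : ‖μ‖ ^ 2 ≤ 2 * μ.re := by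
    rw [← normSq_eq_norm_sq, normSq_apply] at h3 ⊢
    simp only [sub_re, sub_im, one_re, one_im] at h3
    nlinarith
  exact ⟨by linarith, h5⟩

/-- Concavity of `log cos`: its derivative `-tan` is decreasing, so the graph lies below its
tangents. -/
theorem log_cos_le_tangent {x y : ℝ} (hx : |x| < Real.pi / 2) (hy : |y| < Real.pi / 2) :
    Real.log (Real.cos y) ≤ Real.log (Real.cos x) - Real.tan x * (y - x) := by
  rw [abs_lt] at hx hy
  have hder : ∀ s, -(Real.pi / 2) < s → s < Real.pi / 2 →
      HasDerivAt (fun s => Real.log (Real.cos s)) (-Real.tan s) s := fun s h1 h2 => by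
    have hc := Real.cos_pos_of_mem_Ioo ⟨h1, h2⟩
    refine ((Real.hasDerivAt_cos s).log hc.ne').congr_deriv ?_
    rw [Real.tan_eq_sin_div_cos, neg_div]
  rcases lt_trichotomy x y with h | rfl | h
  · obtain ⟨c, hc, hc'⟩ := exists_hasDerivAt_eq_slope (fun s => Real.log (Real.cos s))
      (fun s => -Real.tan s) h
      (fun s hs => (hder s (by linarith [hs.1]) (by linarith [hs.2])).continuousAt.continuousWithinAt)
      (fun s hs => hder s (by linarith [hs.1]) (by linarith [hs.2]))
    have ht : Real.tan x < Real.tan c := Real.tan_lt_tan_of_lt_of_lt_pi_div_two hx.1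
      (by linarith [hc.2]) hc.1
    rw [eq_div_iff (by linarith)] at hc'
    nlinarith
  · simp
  · obtain ⟨c, hc, hc'⟩ := exists_hasDerivAt_eq_slope (fun s => Real.log (Real.cos s))
      (fun s => -Real.tan s) h
      (fun s hs => (hder s (by linarith [hs.1]) (by linarith [hs.2])).continuousAt.continuousWithinAt)
      (fun s hs => hder s (by linarith [hs.1]) (by linarith [hs.2]))
    have ht : Real.tan c < Real.tan x := Real.tan_lt_tan_of_lt_of_lt_pi_div_two
      (by linarith [hc.1]) hx.2 hc.2
    rw [eq_div_iff (by linarith)] at hc'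
    nlinarith

/-- Supporting half-plane of the logarithmic image of the half-plane `Re (c * N) ≥ k * Re c`. -/
theorem re_mul_log_ge {c N : ℂ} {k : ℝ} (hc : ‖c‖ = 1) (hcre : 0 < c.re) (hk : 0 < k)
    (hN : k * c.re ≤ (c * N).re) : c.re * Real.log k ≤ (c * log N).re := by
  have hN0 : N ≠ 0 := by
    rintro rfl
    rw [mul_zero, zero_re] at hN
    nlinarith
  have h1 := norm_mul_cos_arg c
  have h2 := norm_mul_sin_arg c
  have h3 := norm_mul_cos_arg N
  have h4 := norm_mul_sin_arg N
  rw [hc, one_mul] at h1 h2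
  have hψ : |arg c| < Real.pi / 2 := abs_arg_lt_pi_div_two_iff.2 (Or.inl hcre)
  have hNpos : 0 < ‖N‖ := norm_pos_iff.2 hN0
  have hprod : (c * N).re = ‖N‖ * Real.cos (arg c + arg N) := by
    rw [Real.cos_add, mul_re, ← h1, ← h2, ← h3, ← h4]; ring
  have hcos : 0 < Real.cos (arg c + arg N) := by
    by_contra! h
    have := mul_nonpos_of_nonneg_of_nonpos hNpos.le h
    nlinarith
  have hy : |arg c + arg N| < Real.pi / 2 := by
    apply abs_lt_pi_div_two_of_cos_pos _ hcos
    have := abs_lt.1 hψ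
    have h5 := arg_mem_Ioc N
    rw [abs_lt]
    constructor <;> linarith [h5.1, h5.2]
  have ht := log_cos_le_tangent hψ hy
  -- Logarithm of the hypothesis in polar form. Combined with the tangent at `arg c` and multiplied
  -- by `Re c`, it gives the claim, because `tan (arg c) * Re c = Im c`.
  have hl : Real.log k + Real.log (Real.cos (arg c)) ≤
      Real.log ‖N‖ + Real.log (Real.cos (arg c + arg N)) := by
    rw [← Real.log_mul hk.ne' (by rw [h1]; exact hcre.ne'), ← Real.log_mul hNpos.ne' hcos.ne',
      ← hprod, h1]
    exact Real.log_le_log (mul_pos hk hcre) hN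
  have htan : Real.tan (arg c) * c.re = c.im := by
    rw [Real.tan_eq_sin_div_cos, h1, h2, div_mul_cancel₀ _ hcre.ne']
  rw [mul_re, log_re, log_im, ← htan]
  rw [add_sub_cancel_left] at ht
  nlinarith

theorem half_le_re_inv_one_sub {w : ℂ} (hw : ‖w‖ ≤ 1) (hw1 : w ≠ 1) :
    1 / 2 ≤ ((1 - w)⁻¹).re := by
  have h1 : 0 < normSq (1 - w) := normSq_pos.2 (sub_ne_zero.2 hw1.symm)
  have h2 : normSq w ≤ 1 := by
    rw [normSq_eq_norm_sq]; nlinarith [norm_nonneg w]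
  rw [inv_re, le_div_iff₀ h1]
  rw [normSq_apply] at h1 h2 ⊢
  simp only [sub_re, sub_im, one_re, one_im] at h1 ⊢
  nlinarith

theorem half_lt_re_inv_one_sub {w : ℂ} (hw : ‖w‖ < 1) : 1 / 2 < ((1 - w)⁻¹).re := by
  have h1 : 0 < normSq (1 - w) := normSq_pos.2 (one_sub_ne_zero hw)
  have h2 : normSq w < 1 := by
    rw [normSq_eq_norm_sq]; nlinarith [norm_nonneg w]
  rw [inv_re, lt_div_iff₀ h1]
  rw [normSq_apply] at h1 h2 ⊢
  simp only [sub_re, sub_im, one_re, one_im] at h1 ⊢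
  nlinarith

section

variable {μ : ℂ} {r φ : ℝ}

theorem polar_re_im (hμ : μ = r * exp (φ * I)) :
    μ.re = r * Real.cos φ ∧ μ.im = r * Real.sin φ := by
  rw [hμ, re_ofReal_mul, im_ofReal_mul, exp_ofReal_mul_I_re, exp_ofReal_mul_I_im]
  exact ⟨rfl, rfl⟩

/-- The right side is `1 - t (2 cos φ - t)`, so the range `0 < t < 2 cos φ` keeps this point in the
disk. -/
theorem norm_one_sub_exp_mul_sq (φ t : ℝ) :
    ‖1 - exp (-(φ * I)) * t‖ ^ 2 = 1 - 2 * t * Real.cos φ + t ^ 2 := by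
  have h : exp (-(φ * I)) = Real.cos φ - Real.sin φ * I := by
    rw [← neg_mul, exp_mul_I, Complex.cos_neg, Complex.sin_neg, ofReal_cos, ofReal_sin]
    ring
  rw [h, ← normSq_eq_norm_sq, normSq_apply]
  simp only [sub_re, sub_im, mul_re, mul_im, one_re, one_im, ofReal_re, ofReal_im, I_re, I_im]
  linear_combination t ^ 2 * Real.sin_sq_add_cos_sq φ

theorem TwoPointSubordination.modulusInequality {β : ℝ} {f : ℂ → ℂ} (hr : 0 < r)
    (hμ : μ = r * exp (φ * I)) (hφ : 0 < Real.cos φ) (hβ : β < 1)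
    (h : TwoPointSubordination μ β f) : ModulusInequality μ φ β f := by
  rintro t ⟨ht0, ht1⟩ z hz hfz
  have hz' : ‖z‖ < 1 := by simpa using hz
  set v := 1 - exp (-(φ * I)) * t with hv
  have hv1 : ‖v‖ ≤ 1 := by
    have := norm_one_sub_exp_mul_sq φ t
    nlinarith [norm_nonneg v]
  obtain ⟨-, -, ω, -, hω, hs⟩ := h 1 (by simp) v (by simpa using hv1)
  have hs := hs z hz
  have hw := (hω z hz).trans_lt hz'
  simp only [one_mul] at hs
  set w := ω z
  have hvw := norm_mul_lt_one hv1 hw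
  have hvz := norm_mul_lt_one hv1 hz'
  have hw1 := one_sub_ne_zero hw
  set k := 1 - t / (2 * Real.cos φ) with hk
  have hk0 : 0 < k := by
    rw [hk, sub_pos, div_lt_one (by positivity)]
    exact ht1
  have hc : ‖exp (φ * I)‖ = 1 := norm_exp_ofReal_mul_I φ
  have hcre : (exp (φ * I)).re = Real.cos φ := exp_ofReal_mul_I_re φ
  -- Rotation by `exp (iφ)` makes the coefficient of `w / (1 - w)` real, so `Re (w / (1 - w)) ≥
  -- -1/2` puts the values in the half-plane `Re ≥ cos φ - t / 2 = k cos φ`.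
  have hN : (exp (φ * I)) * ((1 - v * w) / (1 - w)) = exp (φ * I) + t * (w / (1 - w)) := by
    have he : exp (φ * I) * exp (-(φ * I)) = 1 := by rw [← exp_add]; simp
    have : (1 - v * w) / (1 - w) = 1 + exp (-(φ * I)) * t * (w / (1 - w)) := by
      rw [hv]; field_simp; ring
    rw [this]
    linear_combination t * (w / (1 - w)) * he
  have hbound : Real.cos φ * Real.log k ≤
      (exp (φ * I) * log ((1 - v * w) / (1 - w))).re := by
    rw [← hcre]
    refine re_mul_log_ge hc (by rwa [hcre]) hk0 ?_
    have hre : -(1 / 2) ≤ (w / (1 - w)).re := by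
      have e : w / (1 - w) = (1 - w)⁻¹ - 1 := by field_simp; ring
      rw [e, sub_re, one_re]
      linarith [half_lt_re_inv_one_sub hw]
    rw [hN, add_re, hcre, re_ofReal_mul]
    have : k * Real.cos φ = Real.cos φ - t / 2 := by rw [hk]; field_simp
    rw [this]
    nlinarith
  rw [log_one_sub_div hvw hw] at hbound
  have hright : ‖((1 - w) / (1 - v * w)) ^ ((1 - (β : ℂ)) * μ)‖ ≤
      k ^ (-(μ.re * (1 - β))) := by
    rw [one_sub_div_cpow hw hvw, norm_exp, Real.rpow_def_of_pos hk0]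
    apply Real.exp_le_exp.2
    have e : (log (1 - w) - log (1 - v * w)) * ((1 - (β : ℂ)) * μ) =
        ((-(r * (1 - β)) : ℝ) : ℂ) * (exp (φ * I) * (log (1 - v * w) - log (1 - w))) := by
      rw [hμ]; push_cast; ring
    rw [e, re_ofReal_mul, (polar_re_im hμ).1]
    have := mul_le_mul_of_nonneg_left hbound (mul_nonneg hr.le (sub_pos.2 hβ).le)
    nlinarith
  have hinv : ((1 - v * z) / (1 - z)) ^ μ * ((1 - z) / (1 - v * z)) ^ μ = 1 := by
    rw [one_sub_div_cpow hvz hz', one_sub_div_cpow hz' hvz, ← exp_add]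
    simp [← add_mul]
  rw [mul_comm z v]
  calc ‖f (v * z) / f z‖ = ‖((1 - v * z) / (1 - z)) ^ μ‖ *
      ‖((1 - z) / (1 - v * z)) ^ μ * (f (v * z) / f z)‖ := by
        rw [← norm_mul, ← mul_assoc, hinv, one_mul]
    _ ≤ _ := by
        rw [hs]
        exact mul_le_mul_of_nonneg_left hright (norm_nonneg _)

end

/-! ### From the modulus inequality to the differential inequality. -/

open Filter Topology in
/-- A holomorphic function on the disk with `β ≤ Re g` has `β < Re g` everywhere as soon as this
holds at one point. -/
theorem lt_re_of_le_re {g : ℂ → ℂ} (hg : DifferentiableOn ℂ g (ball 0 1)) {β : ℝ}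
    (h : ∀ z ∈ ball (0 : ℂ) 1, β ≤ (g z).re) {z₁ : ℂ} (hz₁ : z₁ ∈ ball (0 : ℂ) 1)
    (h₁ : β < (g z₁).re) {z : ℂ} (hz : z ∈ ball (0 : ℂ) 1) : β < (g z).re := by
  rcases (hg.analyticOnNhd isOpen_ball).is_constant_or_isOpen
    (convex_ball (0 : ℂ) 1).isPreconnected with ⟨w, hw⟩ | ho
  · rwa [hw z hz, ← hw z₁ hz₁]
  · have h2 : g '' ball 0 1 ⊆ interior {w : ℂ | β ≤ w.re} :=
      interior_maximal (by rintro _ ⟨w, hw, rfl⟩; exact h w hw) (ho _ subset_rfl isOpen_ball)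
    have h3 := h2 ⟨z, hz, rfl⟩
    rwa [interior_setOfPred_le_re] at h3

section

variable {f : ℂ → ℂ} {μ : ℂ} {β r φ : ℝ}

-- At a zero `z₀` the inequality forces `f` to vanish at all points `z₀ (1 - exp (-iφ) t)`. These
-- accumulate at `z₀`, contradicting isolation of zeros.
open Filter Topology in
theorem ModulusInequality.ne_zero (hf : DifferentiableOn ℂ f (ball 0 1)) (hf0 : f 0 = 1)
    (hφ : 0 < Real.cos φ) (h : ModulusInequality μ φ β f) : ∀ z ∈ ball (0 : ℂ) 1, f z ≠ 0 := by
  intro z₀ hz₀ hfz₀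
  have hz₀' : ‖z₀‖ < 1 := by simpa using hz₀
  have hz₀0 : z₀ ≠ 0 := by
    rintro rfl
    exact one_ne_zero (hf0.symm.trans hfz₀)
  have han := hf.analyticOnNhd isOpen_ball
  rcases (han z₀ hz₀).eventually_eq_zero_or_eventually_ne_zero with h0 | h0
  · have := han.eqOn_zero_of_preconnected_of_eventuallyEq_zero
      (convex_ball (0 : ℂ) 1).isPreconnected hz₀ h0 (mem_ball_self zero_lt_one)
    exact one_ne_zero (hf0.symm.trans this)
  have hzero : ∀ t ∈ Set.Ioo (0 : ℝ) (2 * Real.cos φ),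
      f (z₀ * (1 - exp (-(φ * I)) * t)) = 0 := by
    intro t ht
    set v := 1 - exp (-(φ * I)) * t with hv
    have hv1 : ‖v‖ ≤ 1 := by
      have := norm_one_sub_exp_mul_sq φ t
      nlinarith [norm_nonneg v, ht.1, ht.2]
    set k := (1 - t / (2 * Real.cos φ)) ^ (-(μ.re * (1 - β)))
    have hc1 : ContinuousAt (fun z => f (z * v)) z₀ := by
      have := (differentiableOn_comp_const_mul hf hv1).continuousOn.continuousAt
        (isOpen_ball.mem_nhds hz₀)
      simpa only [mul_comm] using this
    have hc2 : ContinuousAt (fun z => ((1 - z * v) / (1 - z)) ^ μ) z₀ := by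
      have := (differentiableOn_one_sub_div_cpow hv1 (v := 1) (by simp) μ).continuousOn.continuousAt
        (isOpen_ball.mem_nhds hz₀)
      simpa only [mul_comm v, one_mul] using this
    have hc3 : ContinuousAt f z₀ := hf.continuousOn.continuousAt (isOpen_ball.mem_nhds hz₀)
    -- The hypothesis says nothing at `z₀` itself, so the denominator is cleared nearby and the
    -- limit `z → z₀` is taken.
    have hev : ∀ᶠ z in 𝓝[≠] z₀,
        ‖f (z * v)‖ ≤ ‖((1 - z * v) / (1 - z)) ^ μ‖ * k * ‖f z‖ := by
      filter_upwards [h0, nhdsWithin_le_nhds (isOpen_ball.mem_nhds hz₀)] with z hz hzb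
      have := h t ht z hzb hz
      rwa [norm_div, div_le_iff₀ (norm_pos_iff.2 hz)] at this
    have hl1 : Tendsto (fun z => ‖f (z * v)‖) (𝓝[≠] z₀) (𝓝 ‖f (z₀ * v)‖) :=
      (hc1.norm.tendsto).mono_left nhdsWithin_le_nhds
    have hl2 : Tendsto (fun z => ‖((1 - z * v) / (1 - z)) ^ μ‖ * k * ‖f z‖) (𝓝[≠] z₀)
        (𝓝 (‖((1 - z₀ * v) / (1 - z₀)) ^ μ‖ * k * ‖f z₀‖)) :=
      (((hc2.norm.mul continuousAt_const).mul hc3.norm).tendsto).mono_left nhdsWithin_le_nhds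
    have := le_of_tendsto_of_tendsto hl1 hl2 hev
    rw [hfz₀, norm_zero, mul_zero] at this
    exact norm_le_zero_iff.1 this
  have hlim : Tendsto (fun t : ℝ => z₀ * (1 - exp (-(φ * I)) * t)) (𝓝[>] 0) (𝓝[≠] z₀) := by
    rw [tendsto_nhdsWithin_iff]
    constructor
    · have : Continuous fun t : ℝ => z₀ * (1 - exp (-(φ * I)) * t) := by fun_prop
      simpa using (this.tendsto 0).mono_left nhdsWithin_le_nhds
    · filter_upwards [self_mem_nhdsWithin] with t (ht : 0 < t)
      intro heq
      have h1 : z₀ * (exp (-(φ * I)) * t) = 0 := by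
        linear_combination -(Set.mem_singleton_iff.1 heq)
      simp [hz₀0, ht.ne'] at h1
  have hev2 : ∀ᶠ t : ℝ in 𝓝[>] 0, t ∈ Set.Ioo (0 : ℝ) (2 * Real.cos φ) :=
    Ioo_mem_nhdsGT (by positivity)
  obtain ⟨t, ht1, ht2⟩ := ((hlim.eventually h0).and hev2).exists
  exact ht1 (hzero t ht2)

-- In logarithmic form, right side minus left side is nonnegative for small `t > 0` and zero at `t =
-- 0`; its right derivative, scaled by `2 / r`, is the spirallike expression minus `β`.
open Filter Topology in
theorem ModulusInequality.le_re (hf : DifferentiableOn ℂ f (ball 0 1))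
    (hne : ∀ z ∈ ball (0 : ℂ) 1, f z ≠ 0) (hr : 0 < r)
    (hμ : μ = r * exp (φ * I)) (hφ : 0 < Real.cos φ) (h : ModulusInequality μ φ β f)
    {z : ℂ} (hz : z ∈ ball (0 : ℂ) 1) :
    β ≤ (2 / μ * (z * deriv f z / f z) + (1 + z) / (1 - z)).re := by
  have hz' : ‖z‖ < 1 := by simpa using hz
  have hfz := hne z hz
  have hz1 := one_sub_ne_zero hz'
  set c := exp (-(φ * I)) with hc
  have hg : HasDerivAt (fun s : ℂ => z * (1 - c * s)) (-(z * c)) 0 := by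
    have := (((hasDerivAt_id (0 : ℂ)).const_mul c).const_sub 1).const_mul z
    simpa using this
  have hF : HasDerivAt (fun s : ℂ => f (z * (1 - c * s)) / f z)
      (deriv f z * -(z * c) / f z) 0 := by
    have h1 := (hf.differentiableAt (isOpen_ball.mem_nhds hz)).hasDerivAt
    exact (h1.comp_of_eq (0 : ℂ) hg (by simp)).div_const (f z)
  have hM : HasDerivAt (fun s : ℂ => (1 - z * (1 - c * s)) / (1 - z)) (z * c / (1 - z)) 0 := by
    simpa using (hg.const_sub 1).div_const (1 - z)
  have hF0 : f (z * (1 - c * 0)) / f z = 1 := by simp [hfz]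
  have hM0 : (1 - z * (1 - c * 0)) / (1 - z) = 1 := by simp [hz1]
  have hE := ((hM.clog (by rw [hM0]; exact one_mem_slitPlane)).mul_const μ).sub
    (hF.clog (by rw [hF0]; exact one_mem_slitPlane))
  rw [hF0, hM0, div_one, div_one] at hE
  have hE' := HasDerivAt.real_of_complex (z := 0) (by rw [ofReal_zero]; exact hE)
  have hlogk : HasDerivAt (fun t : ℝ => Real.log (1 - t / (2 * Real.cos φ)))
      (-(1 / (2 * Real.cos φ)) / 1) 0 := by
    have := ((hasDerivAt_id (0 : ℝ)).div_const (2 * Real.cos φ)).const_sub 1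
    simpa using this.log (by simp)
  have hD := hE'.sub (hlogk.const_mul (μ.re * (1 - β)))
  have hslope := hD.tendsto_slope_zero_right
  have hpos : ∀ᶠ t : ℝ in 𝓝[>] 0, 0 ≤ t⁻¹ • (((log ((1 - z * (1 - c * (t : ℂ))) / (1 - z)) * μ -
      log (f (z * (1 - c * (t : ℂ))) / f z)).re -
      μ.re * (1 - β) * Real.log (1 - t / (2 * Real.cos φ)))) := by
    have hev1 : ∀ᶠ t : ℝ in 𝓝[>] 0, t ∈ Set.Ioo (0 : ℝ) (2 * Real.cos φ) :=
      Ioo_mem_nhdsGT (by positivity)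
    have hev2 : ∀ᶠ t : ℝ in 𝓝[>] 0, f (z * (1 - c * (t : ℂ))) / f z ≠ 0 := by
      have h1 : Tendsto (fun t : ℝ => f (z * (1 - c * (t : ℂ))) / f z) (𝓝[>] 0) (𝓝 1) := by
        have h2 := hF.continuousAt.tendsto
        simp only [mul_zero, sub_zero, mul_one, div_self hfz] at h2
        have h3 : Tendsto (fun t : ℝ => (t : ℂ)) (𝓝[>] 0) (𝓝 0) := by
          have := (continuous_ofReal.tendsto (0 : ℝ)).mono_left
            (nhdsWithin_le_nhds (s := Set.Ioi (0 : ℝ)))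
          simpa using this
        exact h2.comp h3
      exact h1.eventually_ne one_ne_zero
    filter_upwards [hev1, hev2] with t ht htF
    have hv1 : ‖1 - c * t‖ ≤ 1 := by
      have := norm_one_sub_exp_mul_sq φ t
      nlinarith [norm_nonneg (1 - c * t), ht.1, ht.2]
    have hvz : ‖z * (1 - c * t)‖ < 1 := by
      rw [mul_comm]; exact norm_mul_lt_one hv1 hz'
    have hk : 0 < 1 - t / (2 * Real.cos φ) := by
      rw [sub_pos, div_lt_one (by positivity)]
      exact ht.2
    have key := h t ht z hz hfz
    rw [cpow_def_of_ne_zero (one_sub_div_ne_zero hvz hz'), norm_exp,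
      Real.rpow_def_of_pos hk, ← Real.exp_add, ← Real.log_le_iff_le_exp (norm_pos_iff.2 htF),
      ← log_re] at key
    rw [sub_re]
    refine smul_nonneg (inv_nonneg.2 ht.1.le) ?_
    linarith
  have hfinal := ge_of_tendsto hslope (by
    filter_upwards [hpos] with t ht
    simpa [hz1, hfz] using ht)
  have hcos : μ.re / (2 * Real.cos φ) = r / 2 := by
    rw [(polar_re_im hμ).1]; field_simp
  have hcμ : c * μ = r := by
    rw [hμ, hc, mul_left_comm, ← exp_add]; simp
  have hμ0 : μ ≠ 0 := by
    rw [hμ]; exact mul_ne_zero (ofReal_ne_zero.2 hr.ne') (exp_ne_zero _)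
  have hceq : c = r / μ := by rw [← hcμ]; field_simp
  have e : 2 / μ * (z * deriv f z / f z) + (1 + z) / (1 - z) =
      ((2 / r : ℝ) : ℂ) * (z * c / (1 - z) * μ - deriv f z * -(z * c) / f z) + 1 := by
    have hr' : (r : ℂ) ≠ 0 := ofReal_ne_zero.2 hr.ne'
    rw [hceq]
    push_cast
    field_simp
    ring
  rw [e, add_re, re_ofReal_mul, one_re]
  have h2 : 0 ≤ (z * c / (1 - z) * μ - deriv f z * -(z * c) / f z).re + (1 - β) * (r / 2) := by
    rw [← hcos]
    refine hfinal.trans_eq ?_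
    simp
    ring
  have h3 := mul_nonneg (by positivity : 0 ≤ 2 / r) h2
  have h4 : 2 / r * ((1 - β) * (r / 2)) = 1 - β := by field_simp
  rw [mul_add, h4] at h3
  linarith

theorem differentiableOn_spirallike_expr (hf : DifferentiableOn ℂ f (ball 0 1))
    (hne : ∀ z ∈ ball (0 : ℂ) 1, f z ≠ 0) :
    DifferentiableOn ℂ (fun z => 2 / μ * (z * deriv f z / f z) + (1 + z) / (1 - z))
      (ball 0 1) := by
  refine (((differentiableOn_id.mul (hf.deriv isOpen_ball)).div hf hne).const_mul _).add
    (DifferentiableOn.div (by fun_prop) (by fun_prop) fun z hz => one_sub_ne_zero ?_)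
  simpa using hz

end

/-! ### Univalence. -/

theorem norm_one_sub_inv_lt_one {w : ℂ} (hw : 1 / 2 < w.re) : ‖1 - w⁻¹‖ < 1 := by
  have hw0 : w ≠ 0 := by
    rintro rfl
    norm_num at hw
  have e : 1 - w⁻¹ = (w - 1) / w := by field_simp
  rw [e, norm_div, div_lt_one (norm_pos_iff.2 hw0), ← sq_lt_sq₀ (norm_nonneg _) (norm_nonneg _),
    ← normSq_eq_norm_sq, ← normSq_eq_norm_sq, normSq_apply, normSq_apply]
  simp only [sub_re, sub_im, one_re, one_im]
  nlinarith

/-- A univalence criterion of Noshiro-Warschawski type, transported to the half-plane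
`Re w > 1 / 2` by `w = 1 / (1 - z)`. -/
theorem injOn_of_re_sq_mul_deriv_neg {K k : ℂ → ℂ}
    (hK : ∀ z ∈ ball (0 : ℂ) 1, HasDerivAt K (k z) z)
    (hk : ∀ z ∈ ball (0 : ℂ) 1, ((1 - z) ^ 2 * k z).re < 0) : Set.InjOn K (ball 0 1) := by
  intro a ha b hb hab
  by_contra hne
  rw [mem_ball_zero_iff] at ha hb
  set A := (1 - a)⁻¹ with hA
  set B := (1 - b)⁻¹ with hB
  have hAre := half_lt_re_inv_one_sub ha
  have hBre := half_lt_re_inv_one_sub hb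
  have ha1 : 1 - A⁻¹ = a := by rw [hA, inv_inv]; ring
  have hb1 : 1 - B⁻¹ = b := by rw [hB, inv_inv]; ring
  have hBA : B - A ≠ 0 := fun h => hne (by rw [← ha1, ← hb1, sub_eq_zero.1 h])
  set L : ℝ → ℂ := fun t => A + t * (B - A) with hL
  have hLre : ∀ t ∈ Set.Icc (0 : ℝ) 1, 1 / 2 < (L t).re := by
    intro t ht
    have : (L t).re = (1 - t) * A.re + t * B.re := by
      simp only [hL, add_re, re_ofReal_mul, sub_re]; ring
    rw [this]
    rcases ht.1.eq_or_lt with h | h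
    · rw [← h]; linarith
    · nlinarith [mul_lt_mul_of_pos_left hBre h,
        mul_le_mul_of_nonneg_left hAre.le (sub_nonneg.2 ht.2)]
  -- With `z = 1 - 1 / w` one has `dz/dw = (1 - z)^2`. If `K` took equal values at the endpoints of
  -- the segment, Rolle's theorem would give a zero of this derivative.
  have hder : ∀ t ∈ Set.Icc (0 : ℝ) 1,
      HasDerivAt (fun t => (K (1 - (L t)⁻¹) / (B - A)).re)
        ((1 - (1 - (L t)⁻¹)) ^ 2 * k (1 - (L t)⁻¹)).re t := by
    intro t ht
    have h0 : L t ≠ 0 := fun h => by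
      have := hLre t ht
      rw [h, zero_re] at this
      norm_num at this
    have hl : HasDerivAt (fun s : ℂ => A + s * (B - A)) (B - A) (t : ℂ) := by
      simpa using ((hasDerivAt_id (t : ℂ)).mul_const (B - A)).const_add A
    have h1 := (hl.inv h0).const_sub 1
    have h2 := hK _ (mem_ball_zero_iff.2 (norm_one_sub_inv_lt_one (hLre t ht)))
    have h3 := (h2.comp (t : ℂ) h1).div_const (B - A)
    refine h3.real_of_complex.congr_deriv ?_
    congr 1
    change _ * -(-(B - A) / L t ^ 2) / (B - A) = _
    field_simp
    ring
  obtain ⟨c, hc, hc0⟩ := exists_hasDerivAt_eq_zero (zero_lt_one' ℝ)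
    (fun t ht => (hder t ht).continuousAt.continuousWithinAt)
    (by simp [hL, ha1, hb1, hab]) (fun t ht => hder t (Set.Ioo_subset_Icc_self ht))
  exact (hk _ (mem_ball_zero_iff.2
    (norm_one_sub_inv_lt_one (hLre c (Set.Ioo_subset_Icc_self hc))))).ne hc0

theorem re_inv_add_inv_sub_one_pos {z w : ℂ} (hz : ‖z‖ < 1) (hw : ‖w‖ ≤ 1) (hw1 : w ≠ 1) :
    0 < ((1 - z)⁻¹ + (1 - w)⁻¹ - 1).re := by
  rw [sub_re, add_re, one_re]
  linarith [half_lt_re_inv_one_sub hz, half_le_re_inv_one_sub hw hw1]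

theorem re_inv_pos {w : ℂ} (hw : 0 < w.re) : 0 < (w⁻¹).re := by
  rw [inv_re]
  refine div_pos hw (normSq_pos.2 ?_)
  rintro rfl
  exact lt_irrefl _ hw

/-- The exponential of the sum is the reciprocal of `(1 - x)⁻¹ + (1 - l)⁻¹ - 1`, which has positive
real part; the a priori bound `3π/2` excludes other periods. -/
theorem abs_im_log_sub_log_add_log_lt {x l : ℂ} (hx : ‖x‖ < 1) (hl : ‖l‖ ≤ 1) (hl1 : l ≠ 1) :
    |(log (1 - x) - log (1 - l * x) + log (1 - l)).im| < Real.pi / 2 := by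
  have hlx := norm_mul_lt_one hl hx
  have hlre : 0 < (1 - l).re := by
    have := re_inv_pos (lt_of_lt_of_le (by norm_num) (half_le_re_inv_one_sub hl hl1))
    rwa [inv_inv] at this
  have h1 := abs_lt.1 (abs_log_im_lt_of_re_pos (one_sub_re_pos hx))
  have h2 := abs_lt.1 (abs_log_im_lt_of_re_pos (one_sub_re_pos hlx))
  have h3 := abs_lt.1 (abs_log_im_lt_of_re_pos hlre)
  have hn1 := one_sub_ne_zero hx
  have hn2 := one_sub_ne_zero hlx
  have hn3 : 1 - l ≠ 0 := sub_ne_zero.2 hl1.symm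
  set q := log (1 - x) - log (1 - l * x) + log (1 - l) with hq
  have hexp : exp q = ((1 - x)⁻¹ + (1 - l)⁻¹ - 1)⁻¹ := by
    rw [hq, exp_add, exp_sub, exp_log hn1, exp_log hn2, exp_log hn3]
    have : (1 - x)⁻¹ + (1 - l)⁻¹ - 1 = (1 - l * x) / ((1 - x) * (1 - l)) := by
      rw [eq_div_iff (mul_ne_zero hn1 hn3)]
      field_simp
      ring
    rw [this, inv_div]
    ring
  have hpos : 0 < (exp q).re := by
    rw [hexp]; exact re_inv_pos (re_inv_add_inv_sub_one_pos hx hl hl1)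
  refine abs_lt_pi_div_two_of_cos_pos ?_ ?_
  · rw [hq, add_im, sub_im, abs_lt]
    constructor <;> linarith
  · rw [exp_re] at hpos
    exact (mul_pos_iff_of_pos_left (Real.exp_pos _)).1 hpos

/-- The Schwarz lemma for functions with positive real part. -/
theorem norm_sub_one_le_of_re_pos {p : ℂ → ℂ} (hp : DifferentiableOn ℂ p (ball 0 1))
    (hp0 : p 0 = 1) (hre : ∀ z ∈ ball (0 : ℂ) 1, 0 < (p z).re) {z : ℂ}
    (hz : z ∈ ball (0 : ℂ) 1) : ‖p z - 1‖ ≤ ‖z‖ * ‖p z + 1‖ := by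
  have hne : ∀ w ∈ ball (0 : ℂ) 1, p w + 1 ≠ 0 := fun w hw h => by
    have h1 := hre w hw
    rw [eq_neg_of_add_eq_zero_left h] at h1
    norm_num at h1
  have hd : DifferentiableOn ℂ (fun w => (p w - 1) / (p w + 1)) (ball 0 1) :=
    (hp.sub_const 1).div (hp.add_const 1) hne
  have hmaps : Set.MapsTo (fun w => (p w - 1) / (p w + 1)) (ball 0 1) (closedBall 0 1) := by
    intro w hw
    have h1 := hre w hw
    rw [mem_closedBall_zero_iff, norm_div]
    refine div_le_one_of_le₀ ?_ (norm_nonneg _)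
    rw [← sq_le_sq₀ (norm_nonneg _) (norm_nonneg _), ← normSq_eq_norm_sq, ← normSq_eq_norm_sq,
      normSq_apply, normSq_apply]
    simp only [sub_re, sub_im, add_re, add_im, one_re, one_im]
    nlinarith
  have := norm_le_norm_of_mapsTo_ball hd hmaps (by simp [hp0]) (by simpa using hz)
  rwa [norm_div, div_le_iff₀ (norm_pos_iff.2 (hne z hz))] at this

/-- Writing `(p - 1) / (p + 1) = z w` with `|w| ≤ 1` gives `(1 - z)^2 k = -(1 - z)(1 - w) / (1 - z
w)`, the negative reciprocal of `(1 - z)⁻¹ + (1 - w)⁻¹ - 1`. The exceptional case `w = 1` is `k =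
0`. -/
theorem re_sq_mul_neg_of_norm_le {p z k : ℂ} (hz0 : z ≠ 0) (hz : ‖z‖ < 1) (hp : 0 < p.re)
    (hle : ‖p - 1‖ ≤ ‖z‖ * ‖p + 1‖) (hpk : p = 2 * z * k + (1 + z) / (1 - z)) :
    k = 0 ∨ ((1 - z) ^ 2 * k).re < 0 := by
  have hz1 := one_sub_ne_zero hz
  have hp1 : p + 1 ≠ 0 := fun h => by
    rw [eq_neg_of_add_eq_zero_left h] at hp
    norm_num at hp
  have hk : k = (p * (1 - z) - (1 + z)) / (2 * z * (1 - z)) := by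
    rw [hpk]; field_simp; ring
  set w := (p - 1) / (z * (p + 1)) with hw
  have hwle : ‖w‖ ≤ 1 := by
    rw [hw, norm_div, norm_mul]
    exact div_le_one_of_le₀ hle (by positivity)
  rcases eq_or_ne w 1 with h1 | h1
  · left
    rw [hw, div_eq_one_iff_eq (mul_ne_zero hz0 hp1)] at h1
    rw [hk]
    have : p * (1 - z) - (1 + z) = 0 := by linear_combination h1
    rw [this, zero_div]
  · right
    have hX := re_inv_pos (re_inv_add_inv_sub_one_pos hz hwle h1)
    have hw1 : z * (p + 1) - (p - 1) ≠ 0 := fun h => h1 <| by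
      rw [hw, div_eq_one_iff_eq (mul_ne_zero hz0 hp1)]
      exact (sub_eq_zero.1 h).symm
    have e1 : (1 - w)⁻¹ = z * (p + 1) / (z * (p + 1) - (p - 1)) := by
      rw [hw, one_sub_div (mul_ne_zero hz0 hp1), inv_div]
    have e2 : (1 - z)⁻¹ + (1 - w)⁻¹ - 1 =
        2 * z / ((1 - z) * (z * (p + 1) - (p - 1))) := by
      rw [e1]
      field_simp
      ring
    have e3 : (1 - z) ^ 2 * k = -((1 - z)⁻¹ + (1 - w)⁻¹ - 1)⁻¹ := by
      rw [e2, inv_div, hk]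
      field_simp
      ring
    rw [e3, neg_re]
    exact neg_neg_of_pos hX

section

variable {f : ℂ → ℂ} {μ : ℂ} {β r φ : ℝ}

-- The pointwise alternative gives `≤ 0` off the origin, and continuity gives it there. A single
-- strict value propagates by the open mapping theorem; otherwise `f' = 0` and `f` is constant.
open Filter Topology in
theorem re_sq_mul_logDeriv_neg (hμ : μ ≠ 0) (hf : DifferentiableOn ℂ f (ball 0 1)) (hf0 : f 0 = 1)
    (hne : ∀ z ∈ ball (0 : ℂ) 1, f z ≠ 0)
    (hre : ∀ z ∈ ball (0 : ℂ) 1, 0 < (2 / μ * (z * deriv f z / f z) + (1 + z) / (1 - z)).re)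
    (hnc : ∃ z ∈ ball (0 : ℂ) 1, f z ≠ 1) {z : ℂ} (hz : z ∈ ball (0 : ℂ) 1) :
    ((1 - z) ^ 2 * (deriv f z / f z / μ)).re < 0 := by
  have hkd : DifferentiableOn ℂ (fun z => deriv f z / f z / μ) (ball 0 1) :=
    ((hf.deriv isOpen_ball).div hf hne).div_const μ
  set k : ℂ → ℂ := fun z => deriv f z / f z / μ with hkdef
  have hgd : DifferentiableOn ℂ (fun z => (1 - z) ^ 2 * k z) (ball 0 1) :=
    DifferentiableOn.mul (by fun_prop) hkd
  have hpt : ∀ z ∈ ball (0 : ℂ) 1, z ≠ 0 → k z = 0 ∨ ((1 - z) ^ 2 * k z).re < 0 := by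
    intro z hz hz0
    refine re_sq_mul_neg_of_norm_le hz0 (by simpa using hz) (hre z hz)
      (norm_sub_one_le_of_re_pos (differentiableOn_spirallike_expr hf hne) (by simp) hre hz) ?_
    simp only [hkdef]
    ring
  have hle0 : ∀ z ∈ ball (0 : ℂ) 1, z ≠ 0 → ((1 - z) ^ 2 * k z).re ≤ 0 := fun z hz hz0 => by
    rcases hpt z hz hz0 with h | h
    · simp [h]
    · exact h.le
  have h0mem : (0 : ℂ) ∈ ball (0 : ℂ) 1 := mem_ball_self zero_lt_one
  have hball : ball (0 : ℂ) 1 ∈ 𝓝 0 := isOpen_ball.mem_nhds h0mem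
  have hle : ∀ z ∈ ball (0 : ℂ) 1, ((1 - z) ^ 2 * k z).re ≤ 0 := by
    intro z hz
    rcases eq_or_ne z 0 with rfl | hz0
    · have h1 : Tendsto (fun z => ((1 - z) ^ 2 * k z).re) (𝓝[≠] 0)
          (𝓝 ((1 - 0) ^ 2 * k 0).re) :=
        ((continuous_re.continuousAt.comp (hgd.continuousOn.continuousAt hball)).tendsto).mono_left
          nhdsWithin_le_nhds
      refine le_of_tendsto h1 ?_
      filter_upwards [self_mem_nhdsWithin, nhdsWithin_le_nhds hball] with z hz0 hzb
      exact hle0 z hzb hz0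
    · exact hle0 z hz hz0
  by_cases hall : ∀ z ∈ ball (0 : ℂ) 1, z ≠ 0 → k z = 0
  · exfalso
    have hk0 : k 0 = 0 := by
      have h1 : Tendsto k (𝓝[≠] 0) (𝓝 (k 0)) :=
        (hkd.continuousOn.continuousAt hball).tendsto.mono_left nhdsWithin_le_nhds
      refine tendsto_nhds_unique h1 (tendsto_const_nhds.congr' ?_)
      filter_upwards [self_mem_nhdsWithin, nhdsWithin_le_nhds hball] with z hz0 hzb
      exact (hall z hzb hz0).symm
    have hd0 : (ball (0 : ℂ) 1).EqOn (deriv f) 0 := by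
      intro z hz
      have h1 : k z = 0 := by
        rcases eq_or_ne z 0 with rfl | hz0
        · exact hk0
        · exact hall z hz hz0
      simpa [hkdef, hne z hz, hμ] using h1
    obtain ⟨z, hz, hz1⟩ := hnc
    refine hz1 ?_
    rw [← hf0]
    exact isOpen_ball.is_const_of_deriv_eq_zero (convex_ball (0 : ℂ) 1).isPreconnected hf hd0 hz
      h0mem
  · push Not at hall
    obtain ⟨z₁, hz₁, hz₁0, hk₁⟩ := hall
    have h1 : ((1 - z₁) ^ 2 * k z₁).re < 0 := (hpt z₁ hz₁ hz₁0).resolve_left hk₁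
    have := lt_re_of_le_re (g := fun z => -((1 - z) ^ 2 * k z)) hgd.neg (β := 0)
      (fun z hz => by rw [neg_re]; linarith [hle z hz]) hz₁ (by rw [neg_re]; linarith) hz
    rw [neg_re] at this
    linarith

theorem abs_im_log_sub_lt_pi {W : ℂ → ℂ} (hW0 : W 0 = 0)
    (hW : ∀ z ∈ ball (0 : ℂ) 1, HasDerivAt W (deriv f z / f z) z)
    (hre : ∀ z ∈ ball (0 : ℂ) 1, 0 < (2 / μ * (z * deriv f z / f z) + (1 + z) / (1 - z)).re)
    {a b : ℂ} (ha : ‖a‖ < 1) (hb : ‖b‖ < 1) : |(W b / μ - W a / μ).im| < Real.pi := by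
  rcases eq_or_ne a b with rfl | hab
  · simpa using Real.pi_pos
  have hq := normLog_sub_mem_logRegion (β := 0) one_pos hW0 hW (fun z hz => (hre z hz).le) ha hb
  set q := normLog μ 0 W b - normLog μ 0 W a with hqdef
  have him := abs_lt.1 ((mem_logRegion_iff ha hb).1 hq).1
  have hW' : W b / μ - W a / μ = q + log (1 - b) - log (1 - a) := by
    simp only [hqdef, normLog, ofReal_zero, sub_zero, div_one]; ring
  obtain ⟨-, hl, hexp⟩ := exists_exp_eq_of_mem_logRegion (u := a) (v := b) (z := 1) (q := q)
    (by simpa using ha) (by simpa using hb) hab (by simpa using hq)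
  set l := (1 - exp q) / (a - b * exp q)
  rw [norm_one] at hl
  have hla := norm_mul_lt_one hl ha
  have hlb := norm_mul_lt_one hl hb
  rw [mul_comm a, mul_comm b] at hexp
  have hqlog : q = log (1 - l * a) - log (1 - l * b) := by
    rw [← log_one_sub_div hla hlb, hexp, log_exp him.1 him.2.le]
  rcases eq_or_ne l 1 with h1 | h1
  · rw [hW', hqlog, h1, one_mul, one_mul]
    simpa using Real.pi_pos
  -- Adding `log (1 - l)` to the terms in `a` and in `b` leaves their difference unchanged and
  -- bounds each imaginary part by `π/2`.
  · have h2 := abs_lt.1 (abs_im_log_sub_log_add_log_lt ha hl h1)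
    have h3 := abs_lt.1 (abs_im_log_sub_log_add_log_lt hb hl h1)
    rw [hW', hqlog]
    simp only [add_im, sub_im] at h2 h3 ⊢
    rw [abs_lt]
    constructor <;> linarith

theorem injOn_of_re_pos (hμ : μ ∈ Omega) (hf : DifferentiableOn ℂ f (ball 0 1)) (hf0 : f 0 = 1)
    (hne : ∀ z ∈ ball (0 : ℂ) 1, f z ≠ 0)
    (hre : ∀ z ∈ ball (0 : ℂ) 1, 0 < (2 / μ * (z * deriv f z / f z) + (1 + z) / (1 - z)).re)
    (hnc : ∃ z ∈ ball (0 : ℂ) 1, f z ≠ 1) : Set.InjOn f (ball 0 1) := by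
  obtain ⟨W, hW0, hW, hfW⟩ := exists_holomorphic_log hf hf0 hne
  intro a ha b hb hab
  refine injOn_of_re_sq_mul_deriv_neg (K := fun z => W z / μ)
    (fun z hz => (hW z hz).div_const μ)
    (fun z hz => re_sq_mul_logDeriv_neg hμ.2 hf hf0 hne hre hnc hz) ha hb ?_
  have him := abs_im_log_sub_lt_pi hW0 hW hre (mem_ball_zero_iff.1 ha) (mem_ball_zero_iff.1 hb)
  rw [hfW a ha, hfW b hb, exp_eq_exp_iff_exists_int] at hab
  obtain ⟨n, hn⟩ := hab
  have hμ0 : μ ≠ 0 := hμ.2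
  obtain ⟨h1, h2⟩ := re_pos_of_mem_Omega hμ
  have hn0 : n = 0 := by
    have e : W b / μ - W a / μ = ((-(2 * n * Real.pi) : ℝ) : ℂ) * (I * μ⁻¹) := by
      rw [hn]; push_cast; field_simp; ring
    rw [e, im_ofReal_mul, I_mul_im, inv_re, abs_mul, abs_neg, abs_mul, abs_mul,
      abs_of_pos Real.pi_pos, abs_two, normSq_eq_norm_sq] at him
    -- This is `Re (1 / μ) ≥ 1/2`, the only place where the exact shape of `Omega` matters: a
    -- nonzero `n` would give an imaginary part of modulus at least `π`.
    have h3 : 1 / 2 ≤ μ.re / ‖μ‖ ^ 2 := by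
      rw [le_div_iff₀ (by positivity)]; linarith
    rw [abs_of_pos (by linarith : 0 < μ.re / ‖μ‖ ^ 2)] at him
    have h4 : |(n : ℝ)| < 1 := by
      by_contra! h5
      have h6 : Real.pi ≤ |(n : ℝ)| * Real.pi := by nlinarith [Real.pi_pos]
      nlinarith [mul_le_mul_of_nonneg_left h3 (by positivity : 0 ≤ 2 * |(n : ℝ)| * Real.pi)]
    exact Int.abs_lt_one_iff.1 (by exact_mod_cast h4)
  simp [hn, hn0]

theorem ModulusInequality.isClassG (hμΩ : μ ∈ Omega) (hf : DifferentiableOn ℂ f (ball 0 1))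
    (hf0 : f 0 = 1) (hr : 0 < r) (hμ : μ = r * exp (φ * I)) (hφ : 0 < Real.cos φ)
    (hβ0 : 0 ≤ β) (hβ1 : β < 1) (hf1 : β = 0 → ∃ z ∈ ball (0 : ℂ) 1, f z ≠ 1)
    (h : ModulusInequality μ φ β f) : IsClassG μ β f := by
  have hne := h.ne_zero hf hf0 hφ
  have hre : ∀ z ∈ ball (0 : ℂ) 1,
      β < (2 / μ * (z * deriv f z / f z) + (1 + z) / (1 - z)).re := fun z hz =>
    lt_re_of_le_re (differentiableOn_spirallike_expr hf hne)
      (fun w hw => h.le_re hf hne hr hμ hφ hw) (mem_ball_self zero_lt_one) (by simpa using hβ1) hz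
  refine ⟨hf, ?_, hf0, hne, hre⟩
  refine injOn_of_re_pos hμΩ hf hf0 hne (fun z hz => hβ0.trans_lt (hre z hz)) ?_
  rcases hβ0.eq_or_lt with h0 | h0
  · exact hf1 h0.symm
  · by_contra! hconst
    -- For `f = 1` the expression at `β - 1` equals `β / (2 - β)`, which is below `β` when `0 < β <
    -- 1`.
    have hz : (((β - 1 : ℝ)) : ℂ) ∈ ball (0 : ℂ) 1 := by
      rw [mem_ball_zero_iff, norm_real, Real.norm_eq_abs, abs_lt]
      constructor <;> linarith
    have hd : deriv f ((β - 1 : ℝ) : ℂ) = 0 := by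
      have : f =ᶠ[nhds ((β - 1 : ℝ) : ℂ)] fun _ => 1 := by
        filter_upwards [isOpen_ball.mem_nhds hz] with w hw using hconst w hw
      rw [this.deriv_eq, deriv_const]
    have h1 := hre _ hz
    rw [hd, mul_zero, zero_div, mul_zero, zero_add,
      show (1 + ((β - 1 : ℝ) : ℂ)) / (1 - ((β - 1 : ℝ) : ℂ)) =
        ((β / (2 - β) : ℝ) : ℂ) by push_cast; congr 1 <;> ring, ofReal_re,
      lt_div_iff₀ (by linarith)] at h1
    nlinarith

end

end BoundarySpirallike

theorem corollary3p2 (f : ℂ → ℂ) (hf : DifferentiableOn ℂ f (Metric.ball 0 1)) (hf0 : f 0 = 1)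
    (μ : ℂ) (hμ : μ ∈ BoundarySpirallike.Omega)
    (r φ : ℝ) (hr : 0 < r) (hμ_polar : μ = r * Complex.exp (φ * Complex.I))
    (β : ℝ) (hβ : β ∈ Set.Ico (0 : ℝ) 1)
    (hf1 : β = 0 → ∃ z ∈ Metric.ball (0 : ℂ) 1, f z ≠ 1) :
    (BoundarySpirallike.IsClassG μ β f ↔ BoundarySpirallike.TwoPointSubordination μ β f) ∧
    (BoundarySpirallike.IsClassG μ β f ↔ BoundarySpirallike.ModulusInequality μ φ β f) := by
  have hφ : 0 < Real.cos φ := by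
    have h := (BoundarySpirallike.re_pos_of_mem_Omega hμ).1
    rw [(BoundarySpirallike.polar_re_im hμ_polar).1] at h
    exact (mul_pos_iff_of_pos_left hr).1 h
  have hGa := BoundarySpirallike.IsClassG.twoPointSubordination (f := f) hμ.2 hβ.2
  have hab := BoundarySpirallike.TwoPointSubordination.modulusInequality (f := f) hr hμ_polar hφ
    hβ.2
  have hbG := BoundarySpirallike.ModulusInequality.isClassG hμ hf hf0 hr hμ_polar hφ hβ.1 hβ.2 hf1
  exact ⟨⟨hGa, fun h => hbG (hab h)⟩, ⟨fun h => hab (hGa h), hbG⟩⟩
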